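/- For complex $p$ with $|p|<1$ and $x,a,z\in\mathbb C\setminus\{0\}$ put $$\theta(x;p)=\prod_{j\ge 0}(1-p^jx)(1-p^{j+1}/x),\qquad (x;q,p)_m=\prod_{i=0}^{m-1}\theta(xq^i;p)\quad(m\ge0),$$ $$(x_1,x_2;q,p)_m=(x_1;q,p)_m\,(x_2;q,p)_m,\qquad \gamma(z,a;p)=\sum_{k,l\in\mathbb Z}p^{k^2+kl+l^2}a^{k+l}z^{k-l},$$ $$\langle az,a/z;q,p\rangle_m=\prod_{j=0}^{m-1}\gamma\big(zq^{\frac{1-m}2+j},\,aq^{\frac{m-1}2};p\big)$$ (the last expression depends only on the pair $(az,a/z)$ and on $q,p,m$, and not on the choice of $q^{1/2}$). Let $n\ge 0$ be an integer, let $p,q,a,c,z$ be complex numbers with $|p|<1$ and $q,a,c,z\ne 0$, and fix a fourth root $q^{1/4}$ of $q$, all fractional powers of $q$ being powers of it. Suppose that no denominator in the identity below vanishes, that is, $(cz,c/z;q,p)_n\neq0$, $(q;q,p)_n\ne0$, $\big(cq^{n-\frac14};q^{\frac12},p\big)_n\ne0$, and $\theta\big(cq^{\frac k2-\frac34};p\big)\neq0$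 for $0\le k\le n$. Then $$\begin{aligned} &\frac{\langle az,a/z;q,p\rangle_n}{(cz,c/z;q,p)_n}\,\big(cq^{-\frac14},cq^{\frac14};q,p\big)_n\\ &\quad=\sum_{k=0}^n c^k q^{\frac k4(k-2)+nk}\, \frac{\theta\big(cq^{\frac32k-\frac34};p\big)}{\theta\big(cq^{\frac k2-\frac34};p\big)}\, \frac{(q^{-n};q,p)_k}{(q;q,p)_k}\, \frac{\big(cq^{-\frac14};q^{\frac12},p\big)_k}{\big(cq^{n-\frac14};q^{\frac12},p\big)_k}\, \frac{\big(q^{\frac14}z,q^{\frac14}/z;q^{\frac12},p\big)_k}{(cz,c/z;q,p)_k}\\ &\qquad\qquad\times\big\langle acq^{n-1},aq^{1-k}/c;q,p\big\rangle_k\, \big\langle aq^{\frac k2+\frac14},aq^{\frac k2-\frac14};q,p\big\rangle_{n-k}. \end{aligned}$$ -/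

import Mathlib

open Finset

/-- The modified Jacobi theta function `θ(x; p) = ∏_{j ≥ 0} (1 - p^j x)(1 - p^{j+1} / x)`,
for `x ≠ 0` and `|p| < 1`. -/
noncomputable def jacTheta (x p : ℂ) : ℂ :=
  ∏' j : ℕ, ((1 - p ^ j * x) * (1 - p ^ (j + 1) / x))

/-- The theta shifted factorial `(a; q, p)_n = ∏_{k=0}^{n-1} θ(a q^k; p)`, `n ≥ 0`. -/
noncomputable def thetaFac (a q p : ℂ) (n : ℕ) : ℂ :=
  ∏ k ∈ range n, jacTheta (a * q ^ k) p

/-- The cubic theta function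
`γ(z, a; p) = ∑_{k, l ∈ ℤ} p^{k² + k l + l²} a^{k + l} z^{k - l}`
for `a, z ≠ 0`, `|p| < 1`; the double series converges absolutely. -/
noncomputable def cubicGamma (z a p : ℂ) : ℂ :=
  ∑' m : ℤ × ℤ,
    p ^ (m.1 ^ 2 + m.1 * m.2 + m.2 ^ 2) * a ^ (m.1 + m.2) * z ^ (m.1 - m.2)

/-- The cubic theta shifted factorial
`⟨a z, a / z; q, p⟩_n = ∏_{j=0}^{n-1} γ(z q^{(1-n)/2 + j}, a q^{(n-1)/2}; p)`,
as a function of `a` and `z`. The argument `s` is a square root `q^{1/2}` of the base `q`,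
so `q^{(1-n)/2 + j} = s^{1 - n + 2 j}`. -/
noncomputable def cubicFac (a z s p : ℂ) (n : ℕ) : ℂ :=
  ∏ j ∈ range n,
    cubicGamma (z * s ^ (1 - (n : ℤ) + 2 * (j : ℤ))) (a * s ^ ((n : ℤ) - 1)) p

/-- The notation `⟨x, y; q, p⟩_n` is unambiguous: the value of the cubic theta shifted factorial
depends on `a, z` only through `x = a z` and `y = a / z`, and not on the choice of the square root
`s` of `q`. -/
theorem cubicFac_wellDefined {a z a' z' s s' : ℂ} (p : ℂ) (n : ℕ)
    (ha : a ≠ 0) (hz : z ≠ 0) (ha' : a' ≠ 0) (hz' : z' ≠ 0) (hs : s ≠ 0) (hs' : s' ≠ 0)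
    (hx : a * z = a' * z') (hy : a / z = a' / z') (hq : s ^ 2 = s' ^ 2) :
    cubicFac a z s p n = cubicFac a' z' s' p n := by
  have key : ∀ (b w : ℂ), b ≠ 0 → w ≠ 0 → ∀ k l : ℤ,
      b ^ (k + l) * w ^ (k - l) = (b * w) ^ k * (b / w) ^ l := by
    intro b w hb hw k l
    rw [zpow_add₀ hb, zpow_sub₀ hw, mul_zpow, div_zpow]
    ring
  have e1 : ∀ (b w t : ℂ), t ≠ 0 → ∀ j : ℕ,
      (b * t ^ ((n : ℤ) - 1)) * (w * t ^ (1 - (n : ℤ) + 2 * (j : ℤ)))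
        = (b * w) * (t ^ 2) ^ (j : ℤ) := by
    intro b w t ht j
    rw [mul_mul_mul_comm, ← zpow_add₀ ht, ← zpow_natCast t 2, ← zpow_mul]
    congr 2
    push_cast
    ring
  have e2 : ∀ (b w t : ℂ), t ≠ 0 → ∀ j : ℕ,
      (b * t ^ ((n : ℤ) - 1)) / (w * t ^ (1 - (n : ℤ) + 2 * (j : ℤ)))
        = (b / w) * (t ^ 2) ^ ((n : ℤ) - 1 - (j : ℤ)) := by
    intro b w t ht j
    rw [mul_div_mul_comm, ← zpow_sub₀ ht, ← zpow_natCast t 2, ← zpow_mul]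
    congr 2
    push_cast
    ring
  unfold cubicFac cubicGamma
  refine prod_congr rfl fun j _ => tsum_congr fun m => ?_
  rw [mul_assoc, mul_assoc,
    key _ _ (mul_ne_zero ha (zpow_ne_zero _ hs)) (mul_ne_zero hz (zpow_ne_zero _ hs)),
    key _ _ (mul_ne_zero ha' (zpow_ne_zero _ hs')) (mul_ne_zero hz' (zpow_ne_zero _ hs')),
    e1 _ _ _ hs, e1 _ _ _ hs', e2 _ _ _ hs, e2 _ _ _ hs', hx, hy, hq]

/-! Only one cubic theta function is really involved. In each cubic factorial the shift of `a`
compensates the length, so every γ in the identity has the same second argument A = a q^((n-1)/2),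
and both sides are homogeneous of degree n in the values of the single function G(w) = γ(w, A; p).
Splitting the double series by the parity of k + l shows that G lies in the space spanned by
`thetaEven` and `thetaOdd` (`exists_cubicGamma_eq`). By the triple product, θ(bw)θ(b/w) lies in the
same space and is, up to a factor, a 2×2 determinant (`exists_jacTheta_mul_jacTheta`); Weierstrass'
addition formula is then a Plücker relation.

It suffices to treat G(w) = θ(bw)θ(b/w): on an affine line of functions G the identity is polynomial
in one variable, and rescaled products of this kind supply infinitely many points of the line
(`cubicExpands_of_thetaPair`).

For such G the identity is an expansion of a product of m pairs θ(B q^j z)θ(B q^j / z) in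
`expansionBasis`, proved by induction on m (`prod_thetaPair_expansion`). Weierstrass' formula turns
a new factor times a basis element into a combination of two neighbouring basis elements of the next
order; the resulting recurrence for the coefficients is Weierstrass' formula again
(`jacTheta_three_term`). The claim is the case m = n, e = c q^n, B = b q^((1-n)/2), with r = q^(1/4)
throughout. -/

/-! ### Absolute convergence of theta series. -/

open Filter Topology in
theorem summable_pow_mul_sub_one_mul_pow {ρ : ℝ} (h0 : 0 ≤ ρ) (h1 : ρ < 1) (t : ℝ) (ht : 0 ≤ t) :
    Summable fun n : ℕ => ρ ^ (n * (n - 1)) * t ^ n := by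
  -- The n-th term is the n-th power of ρ^(n-1) t, which tends to 0; hence comparison with a
  -- geometric series of ratio 1/2.
  have hlim : Tendsto (fun n : ℕ => ρ ^ (n - 1) * t) atTop (𝓝 0) := by
    have := ((tendsto_pow_atTop_nhds_zero_of_lt_one h0 h1).comp (tendsto_sub_atTop_nat 1)).mul_const t
    simpa using this
  have hev : ∀ᶠ n : ℕ in atTop, ρ ^ (n - 1) * t ≤ 1 / 2 :=
    (hlim.eventually (gt_mem_nhds (by norm_num : (0 : ℝ) < 1 / 2))).mono fun _ h => h.le
  refine Summable.of_norm_bounded_eventually_nat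
    (summable_geometric_of_lt_one (by norm_num) (by norm_num : (1 / 2 : ℝ) < 1)) ?_
  filter_upwards [hev] with n hn
  have e : ρ ^ (n * (n - 1)) * t ^ n = (ρ ^ (n - 1) * t) ^ n := by
    rw [mul_pow, ← pow_mul, mul_comm n]
  rw [e, Real.norm_of_nonneg (by positivity)]
  exact pow_le_pow_left₀ (by positivity) hn n

/-- A Laurent series whose coefficients decay like `p ^ (k ^ 2 - |k|)` converges absolutely. -/
theorem summable_norm_zpow_mul_zpow {p : ℂ} (hp : ‖p‖ < 1) (f : ℤ → ℤ)
    (hf : ∀ k, k ^ 2 - |k| ≤ f k) (x : ℂ) :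
    Summable fun k : ℤ => ‖p ^ f k * x ^ k‖ := by
  have key : ∀ (n : ℕ) (g : ℤ), (n : ℤ) ^ 2 - n ≤ g → ‖p ^ g‖ ≤ ‖p‖ ^ (n * (n - 1)) := by
    intro n g hg
    have e : ((n * (n - 1) : ℕ) : ℤ) = (n : ℤ) ^ 2 - n := by
      cases n with
      | zero => simp
      | succ m => rw [Nat.add_sub_cancel]; push_cast; ring
    obtain ⟨m, rfl⟩ : ∃ m : ℕ, g = m := ⟨g.toNat, by
      rw [Int.toNat_of_nonneg]; exact le_trans (e ▸ Int.natCast_nonneg _) hg⟩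
    rw [zpow_natCast, norm_pow]
    exact pow_le_pow_of_le_one (norm_nonneg _) hp.le (by exact_mod_cast e ▸ hg)
  refine Summable.of_nat_of_neg ?_ ?_
  · refine Summable.of_nonneg_of_le (fun _ => norm_nonneg _) (fun n => ?_)
      (summable_pow_mul_sub_one_mul_pow (norm_nonneg p) hp ‖x‖ (norm_nonneg _))
    rw [norm_mul, zpow_natCast, norm_pow]
    exact mul_le_mul_of_nonneg_right (key n _ (by simpa using hf n)) (by positivity)
  · refine Summable.of_nonneg_of_le (fun _ => norm_nonneg _) (fun n => ?_)
      (summable_pow_mul_sub_one_mul_pow (norm_nonneg p) hp ‖x⁻¹‖ (norm_nonneg _))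
    rw [norm_mul, zpow_neg, ← inv_zpow, zpow_natCast, norm_pow]
    exact mul_le_mul_of_nonneg_right (key n _ (by simpa using hf (-n))) (by positivity)

/-! ### The q-binomial theorem and the Jacobi triple product. -/

/-- `(p; p)_n = ∏_{j=1}^n (1 - p^j)`. -/
noncomputable def eulerFac (p : ℂ) (n : ℕ) : ℂ := ∏ j ∈ range n, (1 - p ^ (j + 1))

theorem one_sub_ne_zero_of_norm_lt_one {w : ℂ} (h : ‖w‖ < 1) : 1 - w ≠ 0 := by
  intro h0
  rw [← sub_eq_zero.mp h0] at h
  simp at h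

theorem norm_pow_succ_lt_one {p : ℂ} (hp : ‖p‖ < 1) (j : ℕ) : ‖p ^ (j + 1)‖ < 1 := by
  rw [norm_pow]; exact pow_lt_one₀ (norm_nonneg _) hp (by omega)

theorem eulerFac_ne_zero {p : ℂ} (hp : ‖p‖ < 1) (n : ℕ) : eulerFac p n ≠ 0 :=
  prod_ne_zero_iff.mpr fun j _ => one_sub_ne_zero_of_norm_lt_one (norm_pow_succ_lt_one hp j)

theorem eulerFac_succ (p : ℂ) (n : ℕ) : eulerFac p (n + 1) = eulerFac p n * (1 - p ^ (n + 1)) :=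
  prod_range_succ _ _

theorem eulerFac_zero (p : ℂ) : eulerFac p 0 = 1 := prod_range_zero _

/-- Rothe's finite `q`-binomial theorem. -/
theorem prod_one_add_pow_mul {p : ℂ} (hp : ‖p‖ < 1) (y : ℂ) (N : ℕ) :
    ∏ j ∈ range N, (1 + p ^ j * y)
      = ∑ k ∈ range (N + 1),
          p ^ (k.choose 2) * (eulerFac p N / (eulerFac p k * eulerFac p (N - k))) * y ^ k := by
  have hE := eulerFac_ne_zero hp
  induction N with
  | zero => simp [eulerFac_zero]
  | succ N ih =>
    rw [prod_range_succ, ih, mul_add, mul_one, sum_range_succ' _ (N + 1)]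
    conv_lhs => enter [1]; rw [sum_range_succ']
    conv_lhs => enter [2]; rw [sum_range_succ]
    conv_rhs => enter [1]; rw [sum_range_succ]
    rw [add_mul, sum_mul]
    simp only [Nat.sub_self, eulerFac_zero, Nat.sub_zero, Nat.choose_zero_succ]
    have h0 : ∀ M, eulerFac p M / (1 * eulerFac p M) = 1 := fun M => by
      rw [one_mul, div_self (hE M)]
    have h0' : ∀ M, eulerFac p M / (eulerFac p M * 1) = 1 := fun M => by
      rw [mul_one, div_self (hE M)]
    rw [h0, h0, h0', h0']
    have hch : ∀ k : ℕ, (k + 1).choose 2 = k.choose 2 + k := fun k => by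
      rw [Nat.choose_succ_succ' k 1, Nat.choose_one_right, add_comm]
    have hstep : ∀ k ∈ range N,
        p ^ ((k + 1).choose 2) * (eulerFac p (N + 1) / (eulerFac p (k + 1) *
            eulerFac p (N + 1 - (k + 1)))) * y ^ (k + 1)
          = p ^ ((k + 1).choose 2) * (eulerFac p N / (eulerFac p (k + 1) *
            eulerFac p (N - (k + 1)))) * y ^ (k + 1)
          + p ^ (k.choose 2) * (eulerFac p N / (eulerFac p k * eulerFac p (N - k))) * y ^ k
            * (p ^ N * y) := by
      intro k hk
      obtain ⟨m, rfl⟩ := Nat.exists_eq_add_of_lt (mem_range.mp hk)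
      have e1 : k + m + 1 + 1 - (k + 1) = m + 1 := by omega
      have e2 : k + m + 1 - (k + 1) = m := by omega
      have e3 : k + m + 1 - k = m + 1 := by omega
      rw [e1, e2, e3, hch, eulerFac_succ p (k + m + 1), eulerFac_succ p k, eulerFac_succ p m]
      have a1 := hE k
      have a2 := hE m
      have a3 := one_sub_ne_zero_of_norm_lt_one (norm_pow_succ_lt_one hp k)
      have a4 := one_sub_ne_zero_of_norm_lt_one (norm_pow_succ_lt_one hp m)
      field_simp
      ring
    rw [sum_congr rfl hstep, sum_add_distrib, hch N]
    ring

/-- With a square root h of p, the triangular exponents become k² - k, a form that also makes sense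
for negative k. -/
theorem pow_choose_two_sq {h : ℂ} (hh : h ≠ 0) (k : ℕ) :
    (h ^ 2) ^ (k.choose 2) = h ^ ((k : ℤ) ^ 2 - k) := by
  induction k with
  | zero => simp
  | succ k ih =>
    have hch : (k + 1).choose 2 = k.choose 2 + k := by
      rw [Nat.choose_succ_succ' k 1, Nat.choose_one_right, add_comm]
    rw [hch, pow_add, ih, ← pow_mul, ← zpow_natCast h (2 * k), ← zpow_add₀ hh]
    congr 1
    push_cast
    ring

theorem prod_neg_div_pow_succ {h x : ℂ} (hh : h ≠ 0) (n : ℕ) :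
    ∏ j ∈ range n, (-(x / (h ^ 2) ^ (j + 1))) = (-x) ^ n * h ^ (-((n : ℤ) ^ 2 + n)) := by
  induction n with
  | zero => simp
  | succ n ih =>
    rw [prod_range_succ, ih, ← pow_mul, pow_succ, div_eq_mul_inv, ← zpow_natCast h, ← zpow_neg]
    have : h ^ (-(((n + 1 : ℕ) : ℤ) ^ 2 + (n + 1 : ℕ)))
        = h ^ (-((n : ℤ) ^ 2 + n)) * h ^ (-((2 * (n + 1) : ℕ) : ℤ)) := by
      rw [← zpow_add₀ hh]; congr 1; push_cast; ring
    rw [this]; ring_nf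

/-- A finite form of the Jacobi triple product. -/
theorem prod_jacTheta_factor {h x : ℂ} (hh : h ≠ 0) (h1 : ‖h ^ 2‖ < 1) (hx : x ≠ 0) (n : ℕ) :
    ∏ j ∈ range n, ((1 - (h ^ 2) ^ j * x) * (1 - (h ^ 2) ^ (j + 1) / x))
      = ∑ j ∈ range (2 * n + 1),
          eulerFac (h ^ 2) (2 * n) / (eulerFac (h ^ 2) j * eulerFac (h ^ 2) (2 * n - j))
          * (h ^ (((j : ℤ) - n) ^ 2 - ((j : ℤ) - n)) * (-x) ^ ((j : ℤ) - n)) := by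
  have hp : h ^ 2 ≠ 0 := pow_ne_zero _ hh
  have hx' : -x ≠ 0 := neg_ne_zero.mpr hx
  -- Rothe's formula with 2n factors, centred by y = -x/p^n: the upper n factors are 1 - p^j x, the
  -- lower n, read backwards, are multiples of 1 - p^(j+1)/x.
  have hR := prod_one_add_pow_mul h1 (-x / (h ^ 2) ^ n) (2 * n)
  have hL : ∏ j ∈ range (2 * n), (1 + (h ^ 2) ^ j * (-x / (h ^ 2) ^ n))
      = (-x) ^ n * h ^ (-((n : ℤ) ^ 2 + n))
        * ∏ j ∈ range n, ((1 - (h ^ 2) ^ j * x) * (1 - (h ^ 2) ^ (j + 1) / x)) := by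
    rw [two_mul, prod_range_add (f := fun j : ℕ => 1 + (h ^ 2) ^ j * (-x / (h ^ 2) ^ n)), ← prod_neg_div_pow_succ hh, prod_mul_distrib,
      ← prod_range_reflect (fun j : ℕ => 1 + (h ^ 2) ^ j * (-x / (h ^ 2) ^ n))]
    rw [mul_comm (∏ j ∈ range n, (1 - (h ^ 2) ^ j * x)), ← mul_assoc]
    refine congr_arg₂ _ (Eq.trans ?_ prod_mul_distrib) ?_
    · refine prod_congr rfl fun j hj => ?_
      obtain ⟨m, rfl⟩ := Nat.exists_eq_add_of_lt (mem_range.mp hj)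
      have : j + m + 1 - 1 - j = m := by omega
      rw [this]
      field_simp
      ring
    · refine prod_congr rfl fun j _ => ?_
      rw [pow_add]
      field_simp
      try ring
  rw [hL] at hR
  have hne : (-x) ^ n * h ^ (-((n : ℤ) ^ 2 + n)) ≠ 0 :=
    mul_ne_zero (pow_ne_zero _ hx') (zpow_ne_zero _ hh)
  refine mul_left_cancel₀ hne (hR.trans ?_)
  rw [mul_sum]
  refine sum_congr rfl fun j _ => ?_
  rw [pow_choose_two_sq hh, div_pow (-x), ← pow_mul, ← pow_mul, div_eq_mul_inv ((-x) ^ j),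
    ← zpow_natCast h (2 * (n * j)), ← zpow_neg]
  have e1 : (-x) ^ j = (-x) ^ n * (-x) ^ ((j : ℤ) - n) := by
    rw [← zpow_natCast, ← zpow_natCast, ← zpow_add₀ hx']; congr 1; ring
  have e2 : h ^ ((j : ℤ) ^ 2 - j) * h ^ (-((2 * (n * j) : ℕ) : ℤ))
      = h ^ (-((n : ℤ) ^ 2 + n)) * h ^ (((j : ℤ) - n) ^ 2 - ((j : ℤ) - n)) := by
    rw [← zpow_add₀ hh, ← zpow_add₀ hh]; congr 1; push_cast; ring
  rw [e1]
  linear_combination (eulerFac (h ^ 2) (2 * n) / (eulerFac (h ^ 2) j * eulerFac (h ^ 2) (2 * n - j))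
    * (-x) ^ n * (-x) ^ ((j : ℤ) - n)) * e2

theorem summable_pow_const_mul {p : ℂ} (hp : ‖p‖ < 1) (b : ℂ) :
    Summable fun j : ℕ => ‖p ^ j * b‖ := by
  simp_rw [norm_mul, norm_pow]
  exact (summable_geometric_of_lt_one (norm_nonneg _) hp).mul_right _

theorem summable_norm_jacTheta_factor {p : ℂ} (hp : ‖p‖ < 1) (x : ℂ) :
    Summable fun j : ℕ => ‖(1 - p ^ j * x) * (1 - p ^ (j + 1) / x) - 1‖ := by
  refine Summable.of_nonneg_of_le (fun _ => norm_nonneg _) (fun j => ?_)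
    (((summable_pow_const_mul hp x).add (summable_pow_const_mul hp (p / x))).add
      (summable_pow_const_mul hp (x * (p / x))))
  have e : (1 - p ^ j * x) * (1 - p ^ (j + 1) / x) - 1
      = -(p ^ j * x) - p ^ j * (p / x) + p ^ j * (p ^ j * (x * (p / x))) := by ring
  rw [e]
  refine (norm_add_le _ _).trans (add_le_add ((norm_sub_le _ _).trans (by rw [norm_neg])) ?_)
  rw [norm_mul]
  refine mul_le_of_le_one_left (norm_nonneg _) ?_
  rw [norm_pow]
  exact pow_le_one₀ (norm_nonneg _) hp.le

theorem multipliable_jacTheta_factor {p : ℂ} (hp : ‖p‖ < 1) (x : ℂ) :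
    Multipliable fun j : ℕ => (1 - p ^ j * x) * (1 - p ^ (j + 1) / x) := by
  simpa using multipliable_one_add_of_summable (summable_norm_jacTheta_factor hp x)

/-- In the annulus |p| < |x| < 1 no single factor vanishes, and an absolutely convergent product of
nonzero factors is nonzero. -/
theorem jacTheta_ne_zero {x p : ℂ} (hp : ‖p‖ < 1) (h1 : ‖p‖ < ‖x‖) (h2 : ‖x‖ < 1) :
    jacTheta x p ≠ 0 := by
  have hx : 0 < ‖x‖ := (norm_nonneg _).trans_lt h1
  have := tprod_one_add_ne_zero_of_summable
    (f := fun j : ℕ => (1 - p ^ j * x) * (1 - p ^ (j + 1) / x) - 1) (fun j => ?_)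
    (summable_norm_jacTheta_factor hp x)
  · simpa [jacTheta] using this
  · have hj : ‖p‖ ^ j ≤ 1 := pow_le_one₀ (norm_nonneg _) hp.le
    rw [add_sub_cancel]
    refine mul_ne_zero (one_sub_ne_zero_of_norm_lt_one ?_) (one_sub_ne_zero_of_norm_lt_one ?_)
    · rw [norm_mul, norm_pow]
      exact (mul_le_of_le_one_left hx.le hj).trans_lt h2
    · rw [norm_div, norm_pow, div_lt_one hx, pow_succ]
      exact (mul_le_of_le_one_left (norm_nonneg _) hj).trans_lt h1

open Filter Topology in
theorem exists_tendsto_eulerFac {p : ℂ} (hp : ‖p‖ < 1) :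
    ∃ E : ℂ, E ≠ 0 ∧ Tendsto (eulerFac p) atTop (𝓝 E) := by
  have hs : Summable fun j : ℕ => ‖-p ^ (j + 1)‖ := by
    simpa [pow_succ] using summable_pow_const_mul hp p
  refine ⟨_, tprod_one_add_ne_zero_of_summable (fun j => ?_) hs, ?_⟩
  · rw [← sub_eq_add_neg]
    exact one_sub_ne_zero_of_norm_lt_one (norm_pow_succ_lt_one hp j)
  · have := (multipliable_one_add_of_summable hs).hasProd.tendsto_prod_nat
    simp only [← sub_eq_add_neg] at this ⊢
    exact this

open Filter Topology in
/-- The Jacobi triple product identity, up to the value of the constant. -/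
theorem exists_jacTheta_eq_tsum {h : ℂ} (h1 : ‖h‖ < 1) :
    ∃ C : ℂ, C ≠ 0 ∧ ∀ x : ℂ, x ≠ 0 →
      jacTheta x (h ^ 2) = C * ∑' k : ℤ, h ^ (k ^ 2 - k) * (-x) ^ k := by
  -- For h = 0 the exponent k² - k vanishes only at k = 0 and k = 1, and 0^0 = 1, so both sides are
  -- 1 - x.
  rcases eq_or_ne h 0 with rfl | hh
  · refine ⟨1, one_ne_zero, fun x _ => ?_⟩
    have hl : jacTheta x (0 ^ 2) = 1 - x := by
      rw [jacTheta, tprod_eq_mulSingle 0]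
      · simp
      · intro j hj
        simp [hj]
    rw [hl, tsum_eq_sum (s := {0, 1})]
    · simp; ring
    · intro k hk
      simp only [Finset.mem_insert, Finset.mem_singleton, not_or] at hk
      rw [zero_zpow, zero_mul]
      have : k ^ 2 - k = k * (k - 1) := by ring
      rw [this]
      exact mul_ne_zero hk.1 (sub_ne_zero.mpr hk.2)
  have hp : ‖h ^ 2‖ < 1 := by
    rw [norm_pow]; exact pow_lt_one₀ (norm_nonneg _) h1 two_ne_zero
  obtain ⟨E, hE0, hE⟩ := exists_tendsto_eulerFac hp
  obtain ⟨A, hA⟩ := (Metric.isBounded_range_of_tendsto _ hE).exists_norm_le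
  obtain ⟨A', hA'⟩ := (Metric.isBounded_range_of_tendsto _ (hE.inv₀ hE0)).exists_norm_le
  have hA : ∀ n, ‖eulerFac (h ^ 2) n‖ ≤ A := fun n => hA _ ⟨n, rfl⟩
  have hA' : ∀ n, ‖(eulerFac (h ^ 2) n)⁻¹‖ ≤ A' := fun n => hA' _ ⟨n, rfl⟩
  refine ⟨E⁻¹, inv_ne_zero hE0, fun x hx => ?_⟩
  -- The terms of the finite triple product, indexed by the centred k and extended by zero to all of
  -- ℤ.
  let F : ℕ → ℤ → ℂ := fun n k =>
    if -(n : ℤ) ≤ k ∧ k ≤ n then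
      eulerFac (h ^ 2) (2 * n) * (eulerFac (h ^ 2) (k + n).toNat)⁻¹ *
        (eulerFac (h ^ 2) (n - k).toNat)⁻¹ * (h ^ (k ^ 2 - k) * (-x) ^ k)
    else 0
  have hF : ∀ n, ∏ j ∈ range n, ((1 - (h ^ 2) ^ j * x) * (1 - (h ^ 2) ^ (j + 1) / x))
      = ∑' k, F n k := by
    intro n
    rw [prod_jacTheta_factor hh hp hx,
      tsum_eq_sum (s := (range (2 * n + 1)).image fun j : ℕ => (j : ℤ) - n)]
    · rw [sum_image fun a _ b _ hab => by simpa using hab]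
      refine sum_congr rfl fun j hj => ?_
      have hj := mem_range.mp hj
      have e1 : ((j : ℤ) - n + n).toNat = j := by omega
      have e2 : ((n : ℤ) - (j - n)).toNat = 2 * n - j := by omega
      simp only [F]
      rw [if_pos (by omega), e1, e2]
      ring
    · intro k hk
      simp only [F]
      refine if_neg fun hk' => hk ?_
      simp only [mem_image, mem_range]
      exact ⟨(k + n).toNat, by omega, by omega⟩
  have hlim1 : Tendsto (fun n => ∑' k, F n k) atTop (𝓝 (jacTheta x (h ^ 2))) := by
    simp_rw [← hF]
    exact (multipliable_jacTheta_factor hp x).hasProd.tendsto_prod_nat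
  have hsum := summable_norm_zpow_mul_zpow h1 (fun k => k ^ 2 - k)
    (fun k => by have := le_abs_self k; omega) (-x)
  have hlim2 : Tendsto (fun n => ∑' k, F n k) atTop
      (𝓝 (∑' k : ℤ, E⁻¹ * (h ^ (k ^ 2 - k) * (-x) ^ k))) := by
    -- The q-binomial quotients are bounded by A A'², since (p;p)_n and its inverse converge, and
    -- they tend to E · E⁻¹ · E⁻¹ = E⁻¹.
    refine tendsto_tsum_of_dominated_convergence (hsum.mul_left (A * A' * A')) (fun k => ?_)
      (Eventually.of_forall fun n k => ?_)
    · have t1 : Tendsto (fun n : ℕ => 2 * n) atTop atTop :=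
        tendsto_atTop_mono (fun n => by simp only [id]; omega) tendsto_id
      have t2 : Tendsto (fun n : ℕ => (k + n).toNat) atTop atTop :=
        tendsto_atTop_mono (fun n => by omega) (tendsto_sub_atTop_nat k.natAbs)
      have t3 : Tendsto (fun n : ℕ => ((n : ℤ) - k).toNat) atTop atTop :=
        tendsto_atTop_mono (fun n => by omega) (tendsto_sub_atTop_nat k.natAbs)
      have hl := (((hE.comp t1).mul ((hE.inv₀ hE0).comp t2)).mul ((hE.inv₀ hE0).comp t3)).mul_const
        (h ^ (k ^ 2 - k) * (-x) ^ k)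
      rw [mul_inv_cancel₀ hE0, one_mul] at hl
      refine hl.congr' ?_
      filter_upwards [eventually_ge_atTop k.natAbs] with n hn
      simp only [F]
      rw [if_pos (by omega)]
      rfl
    · have hA0 : 0 ≤ A := (norm_nonneg _).trans (hA 0)
      have hA0' : 0 ≤ A' := (norm_nonneg _).trans (hA' 0)
      simp only [F]
      split_ifs
      · rw [norm_mul, norm_mul, norm_mul]
        gcongr
        · exact hA _
        · exact hA' _
        · exact hA' _
      · rw [norm_zero]; positivity
  rw [tendsto_nhds_unique hlim1 hlim2, tsum_mul_left]

/-! ### Even theta functions of degree two. -/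

/-- The even part `∑ p^(d²) z^(2d)` in the decomposition of even theta functions of degree two. -/
noncomputable def thetaEven (p z : ℂ) : ℂ := ∑' d : ℤ, p ^ (d ^ 2) * z ^ (2 * d)

/-- The odd part `∑ p^(d² + d) z^(2d + 1)` in the decomposition of even theta functions of
degree two. -/
noncomputable def thetaOdd (p z : ℂ) : ℂ := ∑' d : ℤ, p ^ (d ^ 2 + d) * z ^ (2 * d + 1)

/-- The nome p may be 0, where the law of exponents fails for mixed signs; all exponents of p below
are nonnegative. -/
theorem zpow_add_of_nonneg (p : ℂ) {m n : ℤ} (hm : 0 ≤ m) (hn : 0 ≤ n) :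
    p ^ (m + n) = p ^ m * p ^ n := by
  lift m to ℕ using hm
  lift n to ℕ using hn
  rw [← Nat.cast_add, zpow_natCast, zpow_natCast, zpow_natCast, pow_add]

theorem zero_le_sq_add_self (d : ℤ) : 0 ≤ d ^ 2 + d := by
  rcases le_or_gt 0 d with h | h
  · positivity
  · nlinarith

theorem zero_le_sq_sub_self (d : ℤ) : 0 ≤ d ^ 2 - d := by
  have := zero_le_sq_add_self (-d)
  linarith [neg_sq d]

theorem summable_norm_zpow_mul_zpow_two_mul {p : ℂ} (hp : ‖p‖ < 1) (f : ℤ → ℤ)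
    (hf : ∀ k, k ^ 2 - |k| ≤ f k) (x : ℂ) :
    Summable fun k : ℤ => ‖p ^ f k * x ^ (2 * k)‖ := by
  have := summable_norm_zpow_mul_zpow hp f hf (x ^ 2)
  refine this.congr fun k => ?_
  rw [zpow_mul]; rfl

theorem summable_norm_zpow_mul_zpow_two_mul_add_one {p : ℂ} (hp : ‖p‖ < 1) (f : ℤ → ℤ)
    (hf : ∀ k, k ^ 2 - |k| ≤ f k) {x : ℂ} (hx : x ≠ 0) :
    Summable fun k : ℤ => ‖p ^ f k * x ^ (2 * k + 1)‖ := by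
  refine ((summable_norm_zpow_mul_zpow_two_mul hp f hf x).mul_right ‖x‖).congr fun k => ?_
  rw [← norm_mul, zpow_add_one₀ hx, mul_assoc]

/-- Splitting pairs of integers according to the parity of their sum. -/
def parityMap : (ℤ × ℤ) ⊕ (ℤ × ℤ) → ℤ × ℤ
  | Sum.inl m => (m.1 + m.2, m.1 - m.2)
  | Sum.inr m => (m.1 + m.2 + 1, m.1 - m.2)

theorem parityMap_bijective : Function.Bijective parityMap := by
  constructor
  · rintro (⟨a, b⟩ | ⟨a, b⟩) (⟨c, d⟩ | ⟨c, d⟩) h <;>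
      simp only [parityMap, Prod.mk.injEq] at h
    · obtain ⟨rfl, rfl⟩ : a = c ∧ b = d := by omega
      rfl
    · omega
    · omega
    · obtain ⟨rfl, rfl⟩ : a = c ∧ b = d := by omega
      rfl
  · rintro ⟨k, l⟩
    rcases Int.even_or_odd' (k + l) with ⟨e, he | he⟩
    · exact ⟨Sum.inl (e, k - e), by simp only [parityMap, Prod.mk.injEq]; omega⟩
    · exact ⟨Sum.inr (e, k - e - 1), by simp only [parityMap, Prod.mk.injEq]; omega⟩

theorem tsum_parity {f : ℤ × ℤ → ℂ} {g₁ g₂ g₃ g₄ : ℤ → ℂ}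
    (h₁ : Summable fun k => ‖g₁ k‖) (h₂ : Summable fun k => ‖g₂ k‖)
    (h₃ : Summable fun k => ‖g₃ k‖) (h₄ : Summable fun k => ‖g₄ k‖)
    (he : ∀ e d, f (e + d, e - d) = g₁ e * g₂ d)
    (ho : ∀ e d, f (e + d + 1, e - d) = g₃ e * g₄ d) :
    ∑' m, f m = (∑' e, g₁ e) * ∑' d, g₂ d + (∑' e, g₃ e) * ∑' d, g₄ d := by
  rw [tsum_mul_tsum_of_summable_norm h₁ h₂, tsum_mul_tsum_of_summable_norm h₃ h₄,
    ← (Equiv.ofBijective _ parityMap_bijective).tsum_eq]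
  have e1 : (fun c => f (Equiv.ofBijective _ parityMap_bijective c)) ∘ Sum.inl
      = fun m : ℤ × ℤ => g₁ m.1 * g₂ m.2 := funext fun m => he m.1 m.2
  have e2 : (fun c => f (Equiv.ofBijective _ parityMap_bijective c)) ∘ Sum.inr
      = fun m : ℤ × ℤ => g₃ m.1 * g₄ m.2 := funext fun m => ho m.1 m.2
  rw [Summable.tsum_sum]
  · exact congr_arg₂ (· + ·) (congr_arg (fun F => ∑' m, F m) e1)
      (congr_arg (fun F => ∑' m, F m) e2)
  · rw [e1]; exact summable_mul_of_summable_norm h₁ h₂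
  · rw [e2]; exact summable_mul_of_summable_norm h₃ h₄

/-- The cubic theta function is an even theta function of degree two in `z`. -/
theorem exists_cubicGamma_eq {p a : ℂ} (hp : ‖p‖ < 1) (ha : a ≠ 0) :
    ∃ α β : ℂ, ∀ z : ℂ, z ≠ 0 → cubicGamma z a p = α * thetaEven p z + β * thetaOdd p z := by
  -- The substitution k = e + d, l = e - d diagonalises k² + kl + l² into 3e² + d²; with k = e + d +
  -- 1 it becomes (3e² + 3e + 1) + (d² + d). The sums over e carry `a`, those over d carry z.
  refine ⟨∑' e : ℤ, p ^ (3 * e ^ 2) * a ^ (2 * e),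
    ∑' e : ℤ, p ^ (3 * e ^ 2 + 3 * e + 1) * a ^ (2 * e + 1), fun z hz => ?_⟩
  refine tsum_parity
    (summable_norm_zpow_mul_zpow_two_mul hp (fun e => 3 * e ^ 2) (fun k => ?_) a)
    (summable_norm_zpow_mul_zpow_two_mul hp (fun d => d ^ 2) (fun k => ?_) z)
    (summable_norm_zpow_mul_zpow_two_mul_add_one hp (fun e => 3 * e ^ 2 + 3 * e + 1) (fun k => ?_) ha)
    (summable_norm_zpow_mul_zpow_two_mul_add_one hp (fun d => d ^ 2 + d) (fun k => ?_) hz)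
    (fun e d => ?_) (fun e d => ?_)
  · nlinarith [abs_nonneg k, sq_nonneg k]
  · linarith [abs_nonneg k]
  · nlinarith [neg_abs_le k, sq_abs k, sq_nonneg (|k| - 1), abs_nonneg k]
  · linarith [neg_abs_le k]
  · have e1 : (e + d) ^ 2 + (e + d) * (e - d) + (e - d) ^ 2 = 3 * e ^ 2 + d ^ 2 := by ring
    have e2 : e + d + (e - d) = 2 * e := by ring
    have e3 : e + d - (e - d) = 2 * d := by ring
    simp only [e1, e2, e3]
    rw [zpow_add_of_nonneg p (by positivity) (by positivity)]
    ring
  · have e1 : (e + d + 1) ^ 2 + (e + d + 1) * (e - d) + (e - d) ^ 2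
        = (3 * e ^ 2 + 3 * e + 1) + (d ^ 2 + d) := by ring
    have e2 : e + d + 1 + (e - d) = 2 * e + 1 := by ring
    have e3 : e + d + 1 - (e - d) = 2 * d + 1 := by ring
    simp only [e1, e2, e3]
    rw [zpow_add_of_nonneg p (by linarith [zero_le_sq_add_self e, sq_nonneg e])
      (zero_le_sq_add_self d)]
    ring

theorem tsum_sq_sub_self (p : ℂ) {x : ℂ} (hx : x ≠ 0) :
    ∑' e : ℤ, p ^ (e ^ 2 - e) * x ^ (2 * e) = x * thetaOdd p x := by
  rw [thetaOdd, ← tsum_mul_left, ← (Equiv.addRight (1 : ℤ)).tsum_eq]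
  refine tsum_congr fun e => ?_
  have e1 : (e + 1) ^ 2 - (e + 1) = e ^ 2 + e := by ring
  have e2 : 2 * (e + 1) = 2 * e + 1 + 1 := by ring
  rw [Equiv.coe_addRight, e1, e2, zpow_add_one₀ hx]
  ring

/-- The product `θ(x y) θ(x / y)` as a determinant. -/
theorem exists_jacTheta_mul_jacTheta {p : ℂ} (hp : ‖p‖ < 1) :
    ∃ C : ℂ, C ≠ 0 ∧ ∀ x y : ℂ, x ≠ 0 → y ≠ 0 →
      jacTheta (x * y) p * jacTheta (x / y) p
        = C * x * (thetaOdd p x * thetaEven p y - thetaEven p x * thetaOdd p y) := by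
  obtain ⟨h, rfl⟩ : ∃ h : ℂ, h ^ 2 = p := IsAlgClosed.exists_pow_nat_eq p two_pos
  have h1 : ‖h‖ < 1 := by
    rw [norm_pow] at hp
    exact (sq_lt_one_iff₀ (norm_nonneg _)).mp hp
  obtain ⟨C, hC, hθ⟩ := exists_jacTheta_eq_tsum h1
  refine ⟨C ^ 2, pow_ne_zero _ hC, fun x y hx hy => ?_⟩
  have hs : ∀ w : ℂ, Summable fun k : ℤ => ‖h ^ (k ^ 2 - k) * w ^ k‖ := fun w =>
    summable_norm_zpow_mul_zpow h1 (fun k => k ^ 2 - k)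
      (fun k => by have := le_abs_self k; omega) w
  have hsq : ∀ k : ℤ, (h ^ 2) ^ k = h ^ (2 * k) := fun k => by
    rw [zpow_mul]; rfl
  -- In the product of the two triple product series, x carries k + l and y carries k - l. The sign
  -- (-1)^(k+l) makes the odd part negative, which produces the determinant.
  have key : (∑' k : ℤ, h ^ (k ^ 2 - k) * (-(x * y)) ^ k)
        * ∑' k : ℤ, h ^ (k ^ 2 - k) * (-(x / y)) ^ k
      = (∑' e : ℤ, (h ^ 2) ^ (e ^ 2 - e) * x ^ (2 * e)) * thetaEven (h ^ 2) y
        + (∑' e : ℤ, -((h ^ 2) ^ (e ^ 2) * x ^ (2 * e + 1))) * thetaOdd (h ^ 2) y := by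
    rw [tsum_mul_tsum_of_summable_norm (hs _) (hs _)]
    have hmul : ∀ k l : ℤ, (-(x * y)) ^ k * (-(x / y)) ^ l
        = (-1) ^ (k + l) * x ^ (k + l) * y ^ (k - l) := fun k l => by
      rw [neg_eq_neg_one_mul (x * y), neg_eq_neg_one_mul (x / y), mul_zpow, mul_zpow, mul_zpow,
        div_zpow, zpow_add₀ (by norm_num), zpow_add₀ hx, zpow_sub₀ hy]
      ring
    refine tsum_parity
      (summable_norm_zpow_mul_zpow_two_mul hp (fun e => e ^ 2 - e) (fun k => ?_) x)
      (summable_norm_zpow_mul_zpow_two_mul hp (fun d => d ^ 2) (fun k => ?_) y)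
      ((summable_norm_zpow_mul_zpow_two_mul_add_one hp (fun e => e ^ 2) (fun k => ?_) hx).congr
        fun k => (norm_neg _).symm)
      (summable_norm_zpow_mul_zpow_two_mul_add_one hp (fun d => d ^ 2 + d) (fun k => ?_) hy)
      (fun e d => ?_) (fun e d => ?_)
    · linarith [le_abs_self k]
    · linarith [abs_nonneg k]
    · linarith [abs_nonneg k]
    · linarith [neg_abs_le k]
    · have e1 : ((e + d) ^ 2 - (e + d)) + ((e - d) ^ 2 - (e - d))
          = 2 * (e ^ 2 - e) + 2 * d ^ 2 := by ring
      have e2 : e + d + (e - d) = 2 * e := by ring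
      have e3 : e + d - (e - d) = 2 * d := by ring
      have := zpow_add_of_nonneg h (zero_le_sq_sub_self (e + d)) (zero_le_sq_sub_self (e - d))
      rw [e1, zpow_add_of_nonneg h (by linarith [zero_le_sq_sub_self e]) (by positivity)] at this
      have h2 := hmul (e + d) (e - d)
      rw [e2, e3, zpow_mul (-1 : ℂ)] at h2
      simp only [hsq]
      calc _ = (h ^ ((e + d) ^ 2 - (e + d)) * h ^ ((e - d) ^ 2 - (e - d)))
            * ((-(x * y)) ^ (e + d) * (-(x / y)) ^ (e - d)) := by ring
        _ = _ := by rw [← this, h2]; norm_num; ring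
    · have e1 : ((e + d + 1) ^ 2 - (e + d + 1)) + ((e - d) ^ 2 - (e - d))
          = 2 * e ^ 2 + 2 * (d ^ 2 + d) := by ring
      have e2 : e + d + 1 + (e - d) = 2 * e + 1 := by ring
      have e3 : e + d + 1 - (e - d) = 2 * d + 1 := by ring
      have := zpow_add_of_nonneg h (zero_le_sq_sub_self (e + d + 1)) (zero_le_sq_sub_self (e - d))
      rw [e1, zpow_add_of_nonneg h (by positivity) (by linarith [zero_le_sq_add_self d])] at this
      have h2 := hmul (e + d + 1) (e - d)
      rw [e2, e3, zpow_add_one₀ (by norm_num) (2 * e), zpow_mul (-1 : ℂ)] at h2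
      simp only [hsq]
      calc _ = (h ^ ((e + d + 1) ^ 2 - (e + d + 1)) * h ^ ((e - d) ^ 2 - (e - d)))
            * ((-(x * y)) ^ (e + d + 1) * (-(x / y)) ^ (e - d)) := by ring
        _ = _ := by rw [← this, h2]; norm_num; ring
  have hEv : ∑' e : ℤ, -((h ^ 2) ^ (e ^ 2) * x ^ (2 * e + 1)) = -(x * thetaEven (h ^ 2) x) := by
    rw [tsum_neg, thetaEven, ← tsum_mul_left]
    congr 1
    refine tsum_congr fun e => ?_
    rw [zpow_add_one₀ hx]
    ring
  rw [hθ _ (mul_ne_zero hx hy), hθ _ (div_ne_zero hx hy)]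
  rw [tsum_sq_sub_self _ hx, hEv] at key
  linear_combination C ^ 2 * key

/-! ### Inversion and Weierstrass' addition formula. -/

/-- The exponent k² - k is invariant under k ↦ 1 - k, which replaces x by its inverse up to the
factor -x⁻¹. -/
theorem jacTheta_inv {p x : ℂ} (hp : ‖p‖ < 1) (hx : x ≠ 0) :
    jacTheta x⁻¹ p = -x⁻¹ * jacTheta x p := by
  obtain ⟨h, rfl⟩ : ∃ h : ℂ, h ^ 2 = p := IsAlgClosed.exists_pow_nat_eq p two_pos
  have h1 : ‖h‖ < 1 := by
    rw [norm_pow] at hp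
    exact (sq_lt_one_iff₀ (norm_nonneg _)).mp hp
  obtain ⟨C, hC, hθ⟩ := exists_jacTheta_eq_tsum h1
  rw [hθ _ hx, hθ _ (inv_ne_zero hx), mul_left_comm, ← tsum_mul_left (a := -x⁻¹),
    ← (Equiv.subLeft (1 : ℤ)).tsum_eq]
  congr 1
  refine tsum_congr fun k => ?_
  have e1 : (1 - k) ^ 2 - (1 - k) = k ^ 2 - k := by ring
  rw [Equiv.subLeft_apply, e1, ← inv_neg, inv_zpow', zpow_neg, zpow_sub₀ (neg_ne_zero.mpr hx), zpow_one]
  field_simp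

/-- Weierstrass' addition formula. -/
theorem jacTheta_weierstrass {p x y z w : ℂ} (hp : ‖p‖ < 1) (hx : x ≠ 0) (hy : y ≠ 0)
    (hz : z ≠ 0) (hw : w ≠ 0) :
    jacTheta (w * z) p * jacTheta (w / z) p * (jacTheta (x * y) p * jacTheta (x / y) p)
      = jacTheta (x * z) p * jacTheta (x / z) p * (jacTheta (w * y) p * jacTheta (w / y) p)
        - x / y * (jacTheta (y * z) p * jacTheta (y / z) p
          * (jacTheta (w * x) p * jacTheta (w / x) p)) := by
  obtain ⟨C, hC, h⟩ := exists_jacTheta_mul_jacTheta hp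
  -- What remains is the Plücker relation between the 2×2 determinants formed from the vectors
  -- (`thetaEven`, `thetaOdd`) at the four points.
  simp only [h, hx, hy, hz, hw, ne_eq, not_false_eq_true]
  field_simp
  ring

/-- Weierstrass' addition formula, parametrised by three factorisations of the same number. -/
theorem jacTheta_weierstrass' {p a b c d e f : ℂ} (hp : ‖p‖ < 1) (ha : a ≠ 0)
    (hc : c ≠ 0) (he : e ≠ 0) (hf : f ≠ 0) (h₁ : a * b = e * f) (h₂ : c * d = e * f) :
    d * (jacTheta a p * jacTheta b p * jacTheta (c / e) p * jacTheta (c / f) p)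
      + f * (jacTheta c p * jacTheta d p * jacTheta (e / a) p * jacTheta (e / b) p)
      + b * (jacTheta e p * jacTheta f p * jacTheta (a / c) p * jacTheta (a / d) p) = 0 := by
  -- With x a square root of the common product, a = x·(a/x) and b = x/(a/x), and likewise for the
  -- other pairs. So every theta product is a determinant in the four points x, a/x, c/x, e/x.
  obtain ⟨x, hx⟩ : ∃ x : ℂ, x ^ 2 = e * f := IsAlgClosed.exists_pow_nat_eq _ two_pos
  have hx0 : x ≠ 0 := by
    rintro rfl
    exact mul_ne_zero he hf (by simpa using hx)
  replace hx := hx.symm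
  obtain ⟨C, hC, h⟩ := exists_jacTheta_mul_jacTheta hp
  have pair : ∀ s t u v : ℂ, s ≠ 0 → u ≠ 0 → s * t = x ^ 2 → u * v = x ^ 2 →
      jacTheta s p * jacTheta t p
        = C * x * (thetaOdd p x * thetaEven p (s / x) - thetaEven p x * thetaOdd p (s / x)) ∧
      jacTheta (s / u) p * jacTheta (s / v) p
        = C * (s / x) * (thetaOdd p (s / x) * thetaEven p (u / x)
          - thetaEven p (s / x) * thetaOdd p (u / x)) := by
    intro s t u v hs hu hst huv
    constructor
    · rw [← h x (s / x) hx0 (div_ne_zero hs hx0)]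
      congr 2
      · field_simp
      · field_simp; rw [mul_comm]; exact hst
    · rw [← h (s / x) (u / x) (div_ne_zero hs hx0) (div_ne_zero hu hx0), mul_comm]
      have hv : v ≠ 0 := by
        rintro rfl
        exact hx0 (by simpa using huv.symm)
      congr 2
      · field_simp; rw [mul_comm v]; exact huv.symm
      · field_simp
  obtain ⟨p1, q1⟩ := pair a b c d ha hc (h₁.trans hx) (h₂.trans hx)
  obtain ⟨p2, q2⟩ := pair c d e f hc he (h₂.trans hx) hx
  obtain ⟨p3, q3⟩ := pair e f a b he ha hx (h₁.trans hx)
  rw [mul_assoc (_ * _), mul_assoc (_ * _), mul_assoc (_ * _), p1, p2, p3, q1, q2, q3]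
  have k1 : b = x ^ 2 / a := by field_simp; linear_combination h₁ + hx
  have k2 : d = x ^ 2 / c := by field_simp; linear_combination h₂ + hx
  have k3 : f = x ^ 2 / e := by field_simp; linear_combination hx
  rw [k1, k2, k3]
  field_simp
  ring

/-! ### Basis and coefficients of the elliptic expansion. -/

theorem thetaFac_zero (a q p : ℂ) : thetaFac a q p 0 = 1 := prod_range_zero _

theorem thetaFac_succ (a q p : ℂ) (n : ℕ) :
    thetaFac a q p (n + 1) = thetaFac a q p n * jacTheta (a * q ^ n) p := prod_range_succ _ _

theorem thetaFac_succ' (a q p : ℂ) (n : ℕ) :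
    thetaFac a q p (n + 1) = thetaFac (a * q) q p n * jacTheta a p := by
  rw [thetaFac, prod_range_succ', pow_zero, mul_one, thetaFac]
  refine congr_arg (· * _) (prod_congr rfl fun j _ => ?_)
  rw [pow_succ']
  ring_nf

theorem thetaFac_ne_zero_of_le {a q p : ℂ} {n k : ℕ} (h : thetaFac a q p n ≠ 0) (hk : k ≤ n) :
    thetaFac a q p k ≠ 0 := by
  rw [thetaFac, prod_ne_zero_iff] at h ⊢
  exact fun j hj => h j (mem_range.mpr ((mem_range.mp hj).trans_le hk))

/-- `θ(x z) θ(x / z)`. -/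
noncomputable def thetaPair (p x z : ℂ) : ℂ := jacTheta (x * z) p * jacTheta (x / z) p

/-- The expansion basis `(r z, r/z; r², p)_k ∏_{i=1}^{m-k} θ(e r^{-4i} z) θ(e r^{-4i} / z)`. -/
noncomputable def expansionBasis (p r e z : ℂ) (m k : ℕ) : ℂ :=
  (∏ j ∈ range k, thetaPair p (r * (r ^ 2) ^ j) z)
    * ∏ i ∈ range (m - k), thetaPair p (e * r ^ (-4 * (i : ℤ) - 4)) z

/-- The part common to `expansionCoeff` and `expansionCoeffAux`. -/
noncomputable def expansionCore (p r e B : ℂ) (m k : ℕ) : ℂ :=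
  e ^ k * r ^ ((k : ℤ) * (k - 2))
    * (thetaFac (r ^ (-4 * (m : ℤ))) (r ^ 4) p k / thetaFac (r ^ 4) (r ^ 4) p k)
    / thetaFac (e * r ^ (-1 : ℤ)) (r ^ 2) p k
    * thetaFac (B * e * r ^ (-4 : ℤ)) (r ^ 4) p k
    * thetaFac (B / e * r ^ (4 * (m : ℤ))) (r ^ 4)⁻¹ p k
    * thetaFac (B * r ^ (2 * (k : ℤ) - 1)) (r ^ 2) p (2 * (m - k))

/-- `(e r^{-4m-1}; r², p)_k θ(e r^{6k-3-4m}) / θ(e r^{2k-3-4m})`, with the common factor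
cancelled. -/
noncomputable def expansionLead (p r e : ℂ) (m : ℕ) : ℕ → ℂ
  | 0 => 1
  | k + 1 => jacTheta (e * r ^ (6 * (k : ℤ) + 3 - 4 * m)) p
      * thetaFac (e * r ^ (-4 * (m : ℤ) - 1)) (r ^ 2) p k

/-- The coefficients in the expansion of `(B z, B/z; r⁴, p)_m` in terms of `expansionBasis`. -/
noncomputable def expansionCoeff (p r e B : ℂ) (m k : ℕ) : ℂ :=
  expansionCore p r e B m k * expansionLead p r e m k

/-- An auxiliary coefficient linking the expansions of order `m` and `m + 1`. -/
noncomputable def expansionCoeffAux (p r e B : ℂ) (m k : ℕ) : ℂ :=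
  expansionCore p r e B m k * thetaFac (e * r ^ (-4 * (m : ℤ) - 5)) (r ^ 2) p k

theorem mul_zpow_mul_pow_pow {r : ℂ} (hr : r ≠ 0) (a : ℂ) (i : ℤ) (c j : ℕ) :
    a * r ^ i * (r ^ c) ^ j = a * r ^ (i + c * j) := by
  rw [mul_assoc, ← pow_mul, ← zpow_natCast, ← zpow_add₀ hr]
  push_cast
  rfl

theorem mul_zpow_mul_inv_pow_pow {r : ℂ} (hr : r ≠ 0) (a : ℂ) (i : ℤ) (c j : ℕ) :
    a * r ^ i * ((r ^ c)⁻¹) ^ j = a * r ^ (i - c * j) := by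
  rw [mul_assoc, inv_pow, ← pow_mul, ← zpow_natCast, ← zpow_neg, ← zpow_add₀ hr]
  push_cast
  rfl

/-- The induction step wants to divide by this `thetaPair`. The auxiliary coefficient is the
quotient with common factors already cancelled, so the pair need not be nonzero. -/
theorem expansionCoeffAux_mul {p r e : ℂ} (hr : r ≠ 0) (B : ℂ) (m k : ℕ) :
    expansionCoeffAux p r e B m k * thetaPair p (e * r ^ (4 * (k : ℤ) - 4 * m - 4)) (r ^ (2 * (k : ℤ) + 1))
      = expansionCoeff p r e B m k * (jacTheta (e * r ^ (-4 * (m : ℤ) - 5)) p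
        * jacTheta (e * r ^ (-4 * (m : ℤ) - 3)) p) := by
  have e1 : e * r ^ (4 * (k : ℤ) - 4 * m - 4) * r ^ (2 * (k : ℤ) + 1)
      = e * r ^ (6 * (k : ℤ) - 3 - 4 * m) := by
    rw [mul_assoc, ← zpow_add₀ hr]; ring_nf
  have e2 : e * r ^ (4 * (k : ℤ) - 4 * m - 4) / r ^ (2 * (k : ℤ) + 1)
      = e * r ^ (2 * (k : ℤ) - 5 - 4 * m) := by
    rw [mul_div_assoc, ← zpow_sub₀ hr]; ring_nf
  rw [expansionCoeffAux, expansionCoeff, thetaPair, e1, e2, mul_assoc, mul_assoc]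
  congr 1
  cases k with
  | zero =>
    rw [thetaFac_zero, expansionLead, one_mul, one_mul, mul_comm]
    congr 3 <;> (congr 1; push_cast; ring_nf)
  | succ k =>
    have h1 := thetaFac_succ (e * r ^ (-4 * (m : ℤ) - 5)) (r ^ 2) p (k + 1)
    have h2 := thetaFac_succ' (e * r ^ (-4 * (m : ℤ) - 5)) (r ^ 2) p (k + 1)
    have h3 := thetaFac_succ' (e * r ^ (-4 * (m : ℤ) - 5) * r ^ 2) (r ^ 2) p k
    have e3 : e * r ^ (-4 * (m : ℤ) - 5) * r ^ 2 = e * r ^ (-4 * (m : ℤ) - 3) := by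
      have := mul_zpow_mul_pow_pow hr e (-4 * (m : ℤ) - 5) 2 1
      rw [pow_one] at this
      rw [this]; congr 2; push_cast; ring
    have e4 : e * r ^ (-4 * (m : ℤ) - 3) * r ^ 2 = e * r ^ (-4 * (m : ℤ) - 1) := by
      have := mul_zpow_mul_pow_pow hr e (-4 * (m : ℤ) - 3) 2 1
      rw [pow_one] at this
      rw [this]; congr 2; push_cast; ring
    rw [e3] at h2 h3
    rw [e4] at h3
    rw [mul_zpow_mul_pow_pow hr] at h1
    have e5 : (-4 * (m : ℤ) - 5 + ((2 : ℕ) : ℤ) * ((k + 1 : ℕ) : ℤ))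
      = 2 * ((k + 1 : ℕ) : ℤ) - 5 - 4 * m := by push_cast; ring
    have e6 : 6 * ((k + 1 : ℕ) : ℤ) - 3 - 4 * m = 6 * (k : ℤ) + 3 - 4 * m := by push_cast; ring
    rw [e5] at h1
    rw [expansionLead, e6]
    linear_combination jacTheta (e * r ^ (6 * (k : ℤ) + 3 - 4 * m)) p * (h2 - h1)
      + jacTheta (e * r ^ (6 * (k : ℤ) + 3 - 4 * m)) p * jacTheta (e * r ^ (-4 * (m : ℤ) - 5)) p * h3

/-- The three-term relation behind `expansionCoeff_succ_succ`. -/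
theorem jacTheta_three_term {p r e B : ℂ} (hp : ‖p‖ < 1) (hr : r ≠ 0) (he : e ≠ 0) (hB : B ≠ 0)
    (m k : ℤ) :
    jacTheta (e * r ^ (6 * k - 1 - 4 * m)) p * jacTheta (r ^ (-4 * m - 4)) p
        * jacTheta (B / e * r ^ (4 * m + 4)) p * jacTheta (B * r ^ (4 * m - 2 * k - 1)) p
      = jacTheta (e * r ^ (2 * k - 5 - 4 * m)) p * jacTheta (r ^ (4 * k - 4 * m)) p
        * jacTheta (B / e * r ^ (4 * m - 4 * k)) p * jacTheta (B * r ^ (4 * m + 2 * k + 3)) p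
      - r ^ (-4 * m - 4) * (jacTheta (r ^ (4 * k + 4)) p * jacTheta (e * r ^ (2 * k - 1)) p
        * jacTheta (B / e * r ^ (8 * m + 4 - 4 * k)) p * jacTheta (B * r ^ (2 * k - 1)) p) := by
  have hz : ∀ i : ℤ, r ^ i ≠ 0 := fun i => zpow_ne_zero _ hr
  -- All three pairs have product (B²/e) r^(8m-2k+3), and their mutual quotients are, up to
  -- inversion, the remaining theta arguments.
  have hW := jacTheta_weierstrass' hp (a := B / e * r ^ (4 * m + 4)) (b := B * r ^ (4 * m - 2 * k - 1))
    (c := B / e * r ^ (4 * m - 4 * k)) (d := B * r ^ (4 * m + 2 * k + 3))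
    (e := B / e * r ^ (8 * m + 4 - 4 * k)) (f := B * r ^ (2 * k - 1))
    (mul_ne_zero (div_ne_zero hB he) (hz _)) (mul_ne_zero (div_ne_zero hB he) (hz _))
    (mul_ne_zero (div_ne_zero hB he) (hz _)) (mul_ne_zero hB (hz _))
    (by rw [mul_mul_mul_comm, ← zpow_add₀ hr, mul_mul_mul_comm, ← zpow_add₀ hr]; ring_nf)
    (by rw [mul_mul_mul_comm, ← zpow_add₀ hr, mul_mul_mul_comm, ← zpow_add₀ hr]; ring_nf)
  have hBe : B / e ≠ 0 := div_ne_zero hB he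
  have quot1 : ∀ i j l : ℤ, i - j = l → B / e * r ^ i / (B / e * r ^ j) = r ^ l := by
    rintro i j l rfl
    rw [mul_div_mul_left _ _ hBe, zpow_sub₀ hr]
  have quot2 : ∀ i j l : ℤ, j - i = l → B / e * r ^ i / (B * r ^ j) = (e * r ^ l)⁻¹ := by
    rintro i j l rfl
    rw [zpow_sub₀ hr]
    have := hz i
    have := hz j
    field_simp
  rw [quot1 (4 * m - 4 * k) _ (-4 * m - 4) (by ring), quot2 (4 * m - 4 * k) _ (6 * k - 1 - 4 * m) (by ring),
    quot1 _ (4 * m + 4) (-(4 * k - 4 * m)) (by ring), quot2 _ _ (2 * k - 5 - 4 * m) (by ring),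
    quot1 _ _ (4 * k + 4) (by ring), quot2 _ _ (2 * k - 1) (by ring), zpow_neg,
    jacTheta_inv hp (mul_ne_zero he (hz _)), jacTheta_inv hp (hz _),
    jacTheta_inv hp (mul_ne_zero he (hz _)), jacTheta_inv hp (mul_ne_zero he (hz _))] at hW
  -- The prefactors, combined with those from inverting arguments, share the factor (B/e)
  -- r^(8m-4k+4), which is cancelled at the end.
  have c1 : B * r ^ (4 * m + 2 * k + 3) * (e * r ^ (6 * k - 1 - 4 * m))⁻¹
      = B / e * r ^ (8 * m - 4 * k + 4) := by
    have : r ^ (4 * m + 2 * k + 3) = r ^ (8 * m - 4 * k + 4) * r ^ (6 * k - 1 - 4 * m) := by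
      rw [← zpow_add₀ hr]; ring_nf
    rw [this]
    have := hz (6 * k - 1 - 4 * m)
    field_simp
  have c2 : B * r ^ (2 * k - 1) * ((r ^ (4 * k - 4 * m))⁻¹ * (e * r ^ (2 * k - 5 - 4 * m))⁻¹)
      = B / e * r ^ (8 * m - 4 * k + 4) := by
    have : r ^ (2 * k - 1) = r ^ (8 * m - 4 * k + 4) * r ^ (4 * k - 4 * m) * r ^ (2 * k - 5 - 4 * m) := by
      rw [← zpow_add₀ hr, ← zpow_add₀ hr]; ring_nf
    rw [this]
    have := hz (4 * k - 4 * m)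
    have := hz (2 * k - 5 - 4 * m)
    field_simp
  have c3 : B * r ^ (4 * m - 2 * k - 1) * (e * r ^ (2 * k - 1))⁻¹
      = B / e * r ^ (8 * m - 4 * k + 4) * r ^ (-4 * m - 4) := by
    have : r ^ (4 * m - 2 * k - 1) = r ^ (8 * m - 4 * k + 4) * r ^ (-4 * m - 4) * r ^ (2 * k - 1) := by
      rw [← zpow_add₀ hr, ← zpow_add₀ hr]; ring_nf
    rw [this]
    have := hz (2 * k - 1)
    field_simp
  have hne : B / e * r ^ (8 * m - 4 * k + 4) ≠ 0 := mul_ne_zero hBe (hz _)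
  refine mul_left_cancel₀ hne ?_
  generalize jacTheta (e * r ^ (6 * k - 1 - 4 * m)) p = t1 at *
  generalize jacTheta (e * r ^ (2 * k - 5 - 4 * m)) p = t2 at *
  generalize jacTheta (e * r ^ (2 * k - 1)) p = t3 at *
  generalize jacTheta (r ^ (4 * k - 4 * m)) p = t4 at *
  generalize jacTheta (r ^ (4 * k + 4)) p = t5 at *
  generalize jacTheta (r ^ (-4 * m - 4)) p = t6 at *
  generalize jacTheta (B / e * r ^ (4 * m + 4)) p = t7 at *
  generalize jacTheta (B * r ^ (4 * m - 2 * k - 1)) p = t8 at *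
  generalize jacTheta (B / e * r ^ (4 * m - 4 * k)) p = t9 at *
  generalize jacTheta (B * r ^ (4 * m + 2 * k + 3)) p = t10 at *
  generalize jacTheta (B / e * r ^ (8 * m + 4 - 4 * k)) p = t11 at *
  generalize jacTheta (B * r ^ (2 * k - 1)) p = t12 at *
  linear_combination (-1) * hW - t1 * t6 * t7 * t8 * c1 + t2 * t4 * t9 * t10 * c2
    - t3 * t5 * t11 * t12 * c3

/-! ### Recurrence for the coefficients and the elliptic expansion. -/

section Recurrence

variable {p r e B : ℂ}

theorem pow_succ_mul_zpow (hr : r ≠ 0) (k : ℕ) :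
    e ^ (k + 1) * r ^ (((k + 1 : ℕ) : ℤ) * ((k + 1 : ℕ) - 2))
      = e ^ k * r ^ ((k : ℤ) * (k - 2)) * (e * r ^ (2 * (k : ℤ) - 1)) := by
  have : ((k + 1 : ℕ) : ℤ) * ((k + 1 : ℕ) - 2) = (k : ℤ) * (k - 2) + (2 * k - 1) := by
    push_cast; ring
  rw [this, zpow_add₀ hr, pow_succ]
  ring

theorem thetaFac_zpow_succ (hr : r ≠ 0) (a : ℂ) (i l : ℤ) (c k : ℕ) (h : i + c * k = l) :
    thetaFac (a * r ^ i) (r ^ c) p (k + 1)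
      = thetaFac (a * r ^ i) (r ^ c) p k * jacTheta (a * r ^ l) p := by
  rw [thetaFac_succ, mul_zpow_mul_pow_pow hr, h]

theorem thetaFac_zpow_succ' (hr : r ≠ 0) (a : ℂ) (i l : ℤ) (c k : ℕ) (h : i + c = l) :
    thetaFac (a * r ^ i) (r ^ c) p (k + 1)
      = thetaFac (a * r ^ l) (r ^ c) p k * jacTheta (a * r ^ i) p := by
  have := mul_zpow_mul_pow_pow hr a i c 1
  rw [pow_one, Nat.cast_one, mul_one, h] at this
  rw [thetaFac_succ', this]

theorem thetaFac_inv_zpow_succ (hr : r ≠ 0) (a : ℂ) (i l : ℤ) (c k : ℕ) (h : i - c * k = l) :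
    thetaFac (a * r ^ i) (r ^ c)⁻¹ p (k + 1)
      = thetaFac (a * r ^ i) (r ^ c)⁻¹ p k * jacTheta (a * r ^ l) p := by
  rw [thetaFac_succ, mul_zpow_mul_inv_pow_pow hr, h]

theorem thetaFac_inv_zpow_succ' (hr : r ≠ 0) (a : ℂ) (i l : ℤ) (c k : ℕ) (h : i - c = l) :
    thetaFac (a * r ^ i) (r ^ c)⁻¹ p (k + 1)
      = thetaFac (a * r ^ l) (r ^ c)⁻¹ p k * jacTheta (a * r ^ i) p := by
  have := mul_zpow_mul_inv_pow_pow hr a i c 1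
  rw [pow_one, Nat.cast_one, mul_one, h] at this
  rw [thetaFac_succ', this]

theorem thetaFac_base_succ (k : ℕ) :
    thetaFac (r ^ 4) (r ^ 4) p (k + 1)
      = thetaFac (r ^ 4) (r ^ 4) p k * jacTheta (r ^ (4 * (k : ℤ) + 4)) p := by
  rw [thetaFac_succ, ← pow_mul, ← pow_add, ← zpow_natCast]
  congr 3
  push_cast
  ring

/-- The factor of `expansionCore` not involving the last theta shifted factorial. -/
noncomputable def expansionCorePrefix (p r e B : ℂ) (m k : ℕ) : ℂ :=
  e ^ k * r ^ ((k : ℤ) * (k - 2))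
    * (thetaFac (r ^ (-4 * (m : ℤ))) (r ^ 4) p k / thetaFac (r ^ 4) (r ^ 4) p k)
    / thetaFac (e * r ^ (-1 : ℤ)) (r ^ 2) p k
    * thetaFac (B * e * r ^ (-4 : ℤ)) (r ^ 4) p k
    * thetaFac (B / e * r ^ (4 * (m : ℤ))) (r ^ 4)⁻¹ p k

theorem expansionCorePrefix_succ_succ (hr : r ≠ 0) (m k : ℕ) :
    expansionCorePrefix p r e B (m + 1) (k + 1) = expansionCorePrefix p r e B m k
      * (e * r ^ (2 * (k : ℤ) - 1) * jacTheta (r ^ (-4 * (m : ℤ) - 4)) p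
        / (jacTheta (r ^ (4 * (k : ℤ) + 4)) p * jacTheta (e * r ^ (2 * (k : ℤ) - 1)) p)
        * jacTheta (B * e * r ^ (4 * (k : ℤ) - 4)) p * jacTheta (B / e * r ^ (4 * (m : ℤ) + 4)) p) := by
  have h1 := thetaFac_zpow_succ' (p := p) hr 1 (-4 * ((m + 1 : ℕ) : ℤ)) (-4 * (m : ℤ)) 4 k
    (by push_cast; ring)
  rw [one_mul, one_mul] at h1
  rw [expansionCorePrefix, expansionCorePrefix, pow_succ_mul_zpow hr, h1, thetaFac_base_succ,
    thetaFac_zpow_succ hr e (-1) (2 * (k : ℤ) - 1) 2 k (by push_cast; ring),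
    thetaFac_zpow_succ hr (B * e) (-4) (4 * (k : ℤ) - 4) 4 k (by push_cast; ring),
    thetaFac_inv_zpow_succ' hr (B / e) (4 * ((m + 1 : ℕ) : ℤ)) (4 * (m : ℤ)) 4 k (by push_cast; ring)]
  have e1 : -4 * ((m + 1 : ℕ) : ℤ) = -4 * (m : ℤ) - 4 := by push_cast; ring
  have e2 : 4 * ((m + 1 : ℕ) : ℤ) = 4 * (m : ℤ) + 4 := by push_cast; ring
  rw [e1, e2]
  simp only [div_eq_mul_inv, mul_inv]
  ring

theorem expansionCorePrefix_succ_right (hr : r ≠ 0) (m k : ℕ) :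
    expansionCorePrefix p r e B m (k + 1) = expansionCorePrefix p r e B m k
      * (e * r ^ (2 * (k : ℤ) - 1) * jacTheta (r ^ (4 * (k : ℤ) - 4 * m)) p
        / (jacTheta (r ^ (4 * (k : ℤ) + 4)) p * jacTheta (e * r ^ (2 * (k : ℤ) - 1)) p)
        * jacTheta (B * e * r ^ (4 * (k : ℤ) - 4)) p
        * jacTheta (B / e * r ^ (4 * (m : ℤ) - 4 * k)) p) := by
  have h1 := thetaFac_zpow_succ (p := p) hr 1 (-4 * (m : ℤ)) (4 * (k : ℤ) - 4 * m) 4 k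
    (by push_cast; ring)
  rw [one_mul, one_mul] at h1
  rw [expansionCorePrefix, expansionCorePrefix, pow_succ_mul_zpow hr, h1, thetaFac_base_succ,
    thetaFac_zpow_succ hr e (-1) (2 * (k : ℤ) - 1) 2 k (by push_cast; ring),
    thetaFac_zpow_succ hr (B * e) (-4) (4 * (k : ℤ) - 4) 4 k (by push_cast; ring),
    thetaFac_inv_zpow_succ hr (B / e) (4 * (m : ℤ)) (4 * (m : ℤ) - 4 * k) 4 k (by push_cast; ring)]
  simp only [div_eq_mul_inv, mul_inv]
  ring

theorem expansionLead_succ_succ (m k : ℕ) :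
    expansionLead p r e (m + 1) (k + 1) = jacTheta (e * r ^ (6 * (k : ℤ) - 1 - 4 * m)) p
      * thetaFac (e * r ^ (-4 * (m : ℤ) - 5)) (r ^ 2) p k := by
  have e1 : 6 * (k : ℤ) + 3 - 4 * ((m + 1 : ℕ) : ℤ) = 6 * (k : ℤ) - 1 - 4 * m := by push_cast; ring
  have e2 : -4 * ((m + 1 : ℕ) : ℤ) - 1 = -4 * (m : ℤ) - 5 := by push_cast; ring
  rw [expansionLead, e1, e2]

theorem thetaPair_zpow (hr : r ≠ 0) (a : ℂ) (i j : ℤ) :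
    thetaPair p (a * r ^ i) (r ^ j) = jacTheta (a * r ^ (i + j)) p * jacTheta (a * r ^ (i - j)) p := by
  rw [thetaPair, mul_assoc, mul_div_assoc, ← zpow_add₀ hr, ← zpow_sub₀ hr]

theorem thetaPair_mul_zpow_mul_zpow (hr : r ≠ 0) (a : ℂ) (i j : ℤ) :
    thetaPair p (a * r ^ i) (e * r ^ j)
      = jacTheta (a * e * r ^ (i + j)) p * jacTheta (a / e * r ^ (i - j)) p := by
  rw [thetaPair, mul_mul_mul_comm, mul_div_mul_comm, ← zpow_add₀ hr, ← zpow_sub₀ hr]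

theorem expansionCoeff_succ_zero (hr : r ≠ 0) (m : ℕ) :
    expansionCoeff p r e B (m + 1) 0
      = expansionCoeffAux p r e B m 0 * thetaPair p (B * r ^ (4 * (m : ℤ))) (r ^ (1 : ℤ)) := by
  rw [thetaPair_zpow hr]
  have e1 : 2 * (m + 1) = 2 * m + 1 + 1 := by omega
  simp only [expansionCoeff, expansionCoeffAux, expansionCore, expansionLead, thetaFac_zero, Nat.sub_zero]
  rw [e1, thetaFac_zpow_succ hr B _ (4 * (m : ℤ) + 1) 2 _ (by push_cast; ring_nf),
    thetaFac_zpow_succ hr B _ (4 * (m : ℤ) - 1) 2 _ (by push_cast; ring_nf)]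
  ring

/-- The top coefficient receives only the second Weierstrass term. The shift in θ(q^(-m-1)) is
absorbed by inversion, so no three-term relation is needed. -/
theorem expansionCoeff_succ_self (hp : ‖p‖ < 1) (hr : r ≠ 0) (m : ℕ)
    (h₁ : jacTheta (r ^ (4 * (m : ℤ) + 4)) p ≠ 0) (h₂ : jacTheta (e * r ^ (2 * (m : ℤ) - 1)) p ≠ 0) :
    expansionCoeff p r e B (m + 1) (m + 1)
      = expansionCoeffAux p r e B m m
        * (-(e * r ^ (2 * (m : ℤ) - 5 - 4 * m))
          * thetaPair p (B * r ^ (4 * (m : ℤ))) (e * r ^ (-4 : ℤ))) := by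
  have hc : ∀ m k, expansionCore p r e B m k = expansionCorePrefix p r e B m k
    * thetaFac (B * r ^ (2 * (k : ℤ) - 1)) (r ^ 2) p (2 * (m - k)) := fun _ _ => rfl
  rw [expansionCoeff, expansionCoeffAux, hc, hc, Nat.sub_self, Nat.sub_self, mul_zero, thetaFac_zero,
    thetaFac_zero, expansionLead_succ_succ, expansionCorePrefix_succ_succ hr,
    thetaPair_mul_zpow_mul_zpow hr]
  have hinv : jacTheta (r ^ (-4 * (m : ℤ) - 4)) p
      = -r ^ (-4 * (m : ℤ) - 4) * jacTheta (r ^ (4 * (m : ℤ) + 4)) p := by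
    have := jacTheta_inv hp (zpow_ne_zero (4 * (m : ℤ) + 4) hr)
    rw [← zpow_neg] at this
    have e1 : -(4 * (m : ℤ) + 4) = -4 * (m : ℤ) - 4 := by ring
    rwa [e1] at this
  have e2 : 6 * (m : ℤ) - 1 - 4 * m = 2 * (m : ℤ) - 1 := by ring
  have e3 : 4 * (m : ℤ) + -4 = 4 * (m : ℤ) - 4 := by ring
  have e4 : 4 * (m : ℤ) - -4 = 4 * (m : ℤ) + 4 := by ring
  have e5 : r ^ (2 * (m : ℤ) - 5 - 4 * m) = r ^ (2 * (m : ℤ) - 1) * r ^ (-4 * (m : ℤ) - 4) := by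
    rw [← zpow_add₀ hr]; ring_nf
  rw [hinv, e2, e3, e4, e5]
  field_simp

/-- Once the common factorials are split off, this is `jacTheta_three_term`. -/
theorem expansionCoeff_succ_succ (hp : ‖p‖ < 1) (hr : r ≠ 0) (he : e ≠ 0) (hB : B ≠ 0) {m k : ℕ}
    (hk : k < m) (h₁ : jacTheta (r ^ (4 * (k : ℤ) + 4)) p ≠ 0)
    (h₂ : jacTheta (e * r ^ (2 * (k : ℤ) - 1)) p ≠ 0) :
    expansionCoeff p r e B (m + 1) (k + 1)
      = expansionCoeffAux p r e B m (k + 1)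
          * thetaPair p (B * r ^ (4 * (m : ℤ))) (r ^ (2 * (k : ℤ) + 3))
        + expansionCoeffAux p r e B m k
          * (-(e * r ^ (2 * (k : ℤ) - 5 - 4 * m))
            * thetaPair p (B * r ^ (4 * (m : ℤ))) (e * r ^ (4 * (k : ℤ) - 4 * m - 4))) := by
  obtain ⟨d, rfl⟩ := Nat.exists_eq_add_of_lt hk
  set m := k + d + 1 with hm
  have hc : ∀ m k, expansionCore p r e B m k = expansionCorePrefix p r e B m k
    * thetaFac (B * r ^ (2 * (k : ℤ) - 1)) (r ^ 2) p (2 * (m - k)) := fun _ _ => rfl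
  have s1 : 2 * (m + 1 - (k + 1)) = 2 * d + 1 + 1 := by omega
  have s2 : 2 * (m - (k + 1)) = 2 * d := by omega
  have s3 : 2 * (m - k) = 2 * d + 1 + 1 := by omega
  have hmz : (m : ℤ) = k + d + 1 := by rw [hm]; push_cast; ring
  have hW := jacTheta_three_term hp hr he hB (m : ℤ) k
  rw [thetaPair_zpow hr, thetaPair_mul_zpow_mul_zpow hr, expansionCoeff, expansionCoeffAux,
    expansionCoeffAux, hc, hc, hc, s1, s2, s3, expansionLead_succ_succ,
    expansionCorePrefix_succ_succ hr, expansionCorePrefix_succ_right hr,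
    thetaFac_zpow_succ hr B _ (4 * (m : ℤ) - 2 * k - 1) 2 (2 * d + 1)
      (by rw [hmz]; push_cast; ring),
    thetaFac_zpow_succ hr B (2 * ((k + 1 : ℕ) : ℤ) - 1) (4 * (m : ℤ) - (2 * k + 3)) 2 (2 * d)
      (by rw [hmz]; push_cast; ring),
    thetaFac_zpow_succ' hr B (2 * (k : ℤ) - 1) (2 * ((k + 1 : ℕ) : ℤ) - 1) 2 (2 * d + 1)
      (by push_cast; ring),
    thetaFac_zpow_succ hr B (2 * ((k + 1 : ℕ) : ℤ) - 1) (4 * (m : ℤ) - (2 * k + 3)) 2 (2 * d)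
      (by rw [hmz]; push_cast; ring),
    thetaFac_zpow_succ hr e _ (2 * (k : ℤ) - 5 - 4 * m) 2 k (by push_cast; ring)]
  have e1 : 4 * (m : ℤ) + (2 * k + 3) = 4 * m + 2 * k + 3 := by ring
  have e2 : 4 * (m : ℤ) + (4 * k - 4 * m - 4) = 4 * k - 4 := by ring
  have e3 : 4 * (m : ℤ) - (4 * k - 4 * m - 4) = 8 * m + 4 - 4 * k := by ring
  have e5 : r ^ (2 * (k : ℤ) - 5 - 4 * m) = r ^ (2 * (k : ℤ) - 1) * r ^ (-4 * (m : ℤ) - 4) := by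
    rw [← zpow_add₀ hr]; ring_nf
  rw [e1, e2, e3]
  -- The same power of r occurs inside this theta function; it is hidden so that `e5` splits only
  -- the scalar prefactor.
  generalize hx : jacTheta (e * r ^ (2 * (k : ℤ) - 5 - 4 * m)) p = t at *
  rw [e5]
  clear_value m
  clear hx e5
  generalize jacTheta (e * r ^ (6 * (k : ℤ) - 1 - 4 * m)) p = t1 at *
  generalize jacTheta (e * r ^ (2 * (k : ℤ) - 1)) p = t3 at *
  generalize jacTheta (r ^ (4 * (k : ℤ) - 4 * m)) p = t4 at *
  generalize jacTheta (r ^ (4 * (k : ℤ) + 4)) p = t5 at *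
  generalize jacTheta (r ^ (-4 * (m : ℤ) - 4)) p = t6 at *
  generalize jacTheta (B / e * r ^ (4 * (m : ℤ) + 4)) p = t7 at *
  generalize jacTheta (B * r ^ (4 * (m : ℤ) - 2 * k - 1)) p = t8 at *
  generalize jacTheta (B / e * r ^ (4 * (m : ℤ) - 4 * k)) p = t9 at *
  generalize jacTheta (B * r ^ (4 * (m : ℤ) + 2 * k + 3)) p = t10 at *
  generalize jacTheta (B / e * r ^ (8 * (m : ℤ) + 4 - 4 * k)) p = t11 at *
  generalize jacTheta (B * r ^ (2 * (k : ℤ) - 1)) p = t12 at *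
  generalize jacTheta (B * e * r ^ (4 * (k : ℤ) - 4)) p = t13 at *
  generalize jacTheta (B * r ^ (4 * (m : ℤ) - (2 * k + 3))) p = t14 at *
  generalize expansionCorePrefix p r e B m k = K at *
  generalize thetaFac (e * r ^ (-4 * (m : ℤ) - 5)) (r ^ 2) p k = A at *
  generalize thetaFac (B * r ^ (2 * ((k + 1 : ℕ) : ℤ) - 1)) (r ^ 2) p (2 * d) = H at *
  generalize r ^ (2 * (k : ℤ) - 1) = R at *
  generalize r ^ (-4 * (m : ℤ) - 4) = R' at *
  field_simp
  linear_combination (K * R * A * H * t13 * t14) * hW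

/-- The elliptic expansion in the case of a product of theta functions. -/
theorem prod_thetaPair_expansion (hp : ‖p‖ < 1) (hr : r ≠ 0) (he : e ≠ 0) (hB : B ≠ 0) {z : ℂ}
    (hz : z ≠ 0) (m : ℕ) (h₁ : thetaFac (r ^ 4) (r ^ 4) p m ≠ 0)
    (h₂ : thetaFac (e * r ^ (-1 : ℤ)) (r ^ 2) p m ≠ 0) :
    (∏ j ∈ range m, thetaPair p (B * r ^ (4 * (j : ℤ))) z)
        * ∏ i ∈ range m, (jacTheta (e * r ^ (-4 * (i : ℤ) - 5)) p
          * jacTheta (e * r ^ (-4 * (i : ℤ) - 3)) p)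
      = ∑ k ∈ range (m + 1), expansionCoeff p r e B m k * expansionBasis p r e z m k := by
  induction m with
  | zero =>
    simp [expansionCoeff, expansionBasis, expansionCore, expansionLead, thetaFac_zero]
  | succ m ih =>
    have h₁' : ∀ k ≤ m, jacTheta (r ^ (4 * (k : ℤ) + 4)) p ≠ 0 := fun k hk => by
      have := thetaFac_ne_zero_of_le h₁ (Nat.succ_le_succ hk)
      rw [Nat.succ_eq_add_one, thetaFac_base_succ] at this
      exact right_ne_zero_of_mul this
    have h₂' : ∀ k ≤ m, jacTheta (e * r ^ (2 * (k : ℤ) - 1)) p ≠ 0 := fun k hk => by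
      have := thetaFac_ne_zero_of_le h₂ (Nat.succ_le_succ hk)
      rw [Nat.succ_eq_add_one, thetaFac_zpow_succ hr e (-1) (2 * (k : ℤ) - 1) 2 k
        (by push_cast; ring)] at this
      exact right_ne_zero_of_mul this
    have ih := ih (thetaFac_ne_zero_of_le h₁ (Nat.le_succ m))
      (thetaFac_ne_zero_of_le h₂ (Nat.le_succ m))
    rw [prod_range_succ, prod_range_succ, mul_mul_mul_comm, ih, sum_mul]
    have hterm : ∀ k ∈ range (m + 1),
        expansionCoeff p r e B m k * expansionBasis p r e z m k
            * (thetaPair p (B * r ^ (4 * (m : ℤ))) z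
              * (jacTheta (e * r ^ (-4 * (m : ℤ) - 5)) p * jacTheta (e * r ^ (-4 * (m : ℤ) - 3)) p))
          = expansionCoeffAux p r e B m k
              * thetaPair p (B * r ^ (4 * (m : ℤ))) (r ^ (2 * (k : ℤ) + 1))
              * expansionBasis p r e z (m + 1) k
            + expansionCoeffAux p r e B m k
              * (-(e * r ^ (2 * (k : ℤ) - 5 - 4 * m))
                * thetaPair p (B * r ^ (4 * (m : ℤ))) (e * r ^ (4 * (k : ℤ) - 4 * m - 4)))
              * expansionBasis p r e z (m + 1) (k + 1) := by
      intro k hk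
      have hk : k ≤ m := Nat.lt_succ_iff.mp (mem_range.mp hk)
      have hb1 : expansionBasis p r e z (m + 1) k = expansionBasis p r e z m k
          * thetaPair p (e * r ^ (4 * (k : ℤ) - 4 * m - 4)) z := by
        have s1 : m + 1 - k = (m - k) + 1 := by omega
        have s2 : -4 * ((m - k : ℕ) : ℤ) - 4 = 4 * (k : ℤ) - 4 * m - 4 := by
          push_cast [hk]; ring
        rw [expansionBasis, expansionBasis, s1, prod_range_succ, s2, mul_assoc]
      have hb2 : expansionBasis p r e z (m + 1) (k + 1) = expansionBasis p r e z m k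
          * thetaPair p (r ^ (2 * (k : ℤ) + 1)) z := by
        have s1 : m + 1 - (k + 1) = m - k := by omega
        have s2 : r * (r ^ 2) ^ k = r ^ (2 * (k : ℤ) + 1) := by
          rw [zpow_add_one₀ hr, zpow_mul, mul_comm, zpow_natCast]; rfl
        rw [expansionBasis, expansionBasis, s1, prod_range_succ, s2]
        ring
      have hX : e * r ^ (4 * (k : ℤ) - 4 * m - 4) ≠ 0 := mul_ne_zero he (zpow_ne_zero _ hr)
      have hY : r ^ (2 * (k : ℤ) + 1) ≠ 0 := zpow_ne_zero _ hr
      have hWne : B * r ^ (4 * (m : ℤ)) ≠ 0 := mul_ne_zero hB (zpow_ne_zero _ hr)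
      -- The two nodes are those by which the basis elements k and k + 1 of order m + 1 extend
      -- element k of order m.
      have hw : thetaPair p (B * r ^ (4 * (m : ℤ))) z
            * thetaPair p (e * r ^ (4 * (k : ℤ) - 4 * m - 4)) (r ^ (2 * (k : ℤ) + 1))
          = thetaPair p (e * r ^ (4 * (k : ℤ) - 4 * m - 4)) z
              * thetaPair p (B * r ^ (4 * (m : ℤ))) (r ^ (2 * (k : ℤ) + 1))
            - e * r ^ (4 * (k : ℤ) - 4 * m - 4) / r ^ (2 * (k : ℤ) + 1)
              * (thetaPair p (r ^ (2 * (k : ℤ) + 1)) z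
                * thetaPair p (B * r ^ (4 * (m : ℤ))) (e * r ^ (4 * (k : ℤ) - 4 * m - 4))) :=
        jacTheta_weierstrass hp hX hY hz hWne
      have hq : e * r ^ (4 * (k : ℤ) - 4 * m - 4) / r ^ (2 * (k : ℤ) + 1)
          = e * r ^ (2 * (k : ℤ) - 5 - 4 * m) := by
        rw [mul_div_assoc, ← zpow_sub₀ hr]; ring_nf
      rw [hq] at hw
      have ha := expansionCoeffAux_mul (p := p) (e := e) hr B m k
      rw [hb1, hb2]
      linear_combination (-expansionBasis p r e z m k * thetaPair p (B * r ^ (4 * (m : ℤ))) z) * ha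
        + expansionCoeffAux p r e B m k * expansionBasis p r e z m k * hw
    rw [sum_congr rfl hterm, sum_add_distrib, sum_range_succ', sum_range_succ,
      sum_range_succ' _ (m + 1), sum_range_succ]
    -- An inner basis element k + 1 receives contributions from the old indices k + 1 and k; the end
    -- elements 0 and m + 1 receive one each.
    have hsucc : ∀ k ∈ range m,
        expansionCoeff p r e B (m + 1) (k + 1) * expansionBasis p r e z (m + 1) (k + 1)
          = expansionCoeffAux p r e B m (k + 1)
              * thetaPair p (B * r ^ (4 * (m : ℤ))) (r ^ (2 * ((k + 1 : ℕ) : ℤ) + 1))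
              * expansionBasis p r e z (m + 1) (k + 1)
            + expansionCoeffAux p r e B m k
              * (-(e * r ^ (2 * (k : ℤ) - 5 - 4 * m))
                * thetaPair p (B * r ^ (4 * (m : ℤ))) (e * r ^ (4 * (k : ℤ) - 4 * m - 4)))
              * expansionBasis p r e z (m + 1) (k + 1) := by
      intro k hk
      have hk := mem_range.mp hk
      have s1 : 2 * ((k + 1 : ℕ) : ℤ) + 1 = 2 * (k : ℤ) + 3 := by push_cast; ring
      rw [expansionCoeff_succ_succ hp hr he hB hk (h₁' k hk.le) (h₂' k hk.le), s1, add_mul]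
    have s0 : 2 * ((0 : ℕ) : ℤ) + 1 = 1 := by norm_num
    have s2 : 4 * (m : ℤ) - 4 * m - 4 = -4 := by ring
    rw [sum_congr rfl hsucc, sum_add_distrib, expansionCoeff_succ_zero hr,
      expansionCoeff_succ_self hp hr m (h₁' m le_rfl) (h₂' m le_rfl), s0, s2]
    ring

end Recurrence

/-! ### From theta products to all even theta functions of degree two. -/

/-- The expansion identity for the product `∏ G(z r^{2-2n+4j})`, with coefficients `K` and `M`
that do not depend on `G`. -/
def CubicExpands (n : ℕ) (r c z K : ℂ) (M : ℕ → ℂ) (G : ℂ → ℂ) : Prop :=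
  (∏ j ∈ range n, G (z * r ^ (2 - 2 * (n : ℤ) + 4 * j))) * K
    = ∑ k ∈ range (n + 1), M k * (∏ j ∈ range k, G (c * r ^ (2 * (n : ℤ) - 2 + 4 * j)))
        * ∏ j ∈ range (n - k), G (r ^ (3 - 2 * (n : ℤ) + 2 * k + 4 * j))

section CubicExpands

variable {n : ℕ} {r c z K : ℂ} {M : ℕ → ℂ} {G G' : ℂ → ℂ}

theorem CubicExpands.congr (hr : r ≠ 0) (hc : c ≠ 0) (hz : z ≠ 0) (h : CubicExpands n r c z K M G)
    (hG : ∀ w, w ≠ 0 → G w = G' w) : CubicExpands n r c z K M G' := by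
  have hi : ∀ i : ℤ, r ^ i ≠ 0 := fun i => zpow_ne_zero _ hr
  have e1 : ∀ i : ℤ, G (z * r ^ i) = G' (z * r ^ i) := fun i => hG _ (mul_ne_zero hz (hi i))
  have e2 : ∀ i : ℤ, G (c * r ^ i) = G' (c * r ^ i) := fun i => hG _ (mul_ne_zero hc (hi i))
  have e3 : ∀ i : ℤ, G (r ^ i) = G' (r ^ i) := fun i => hG _ (hi i)
  simpa only [CubicExpands, e1, e2, e3] using h

/-- Both sides are homogeneous of degree n in G, as n = k + (n - k). -/
theorem CubicExpands.const_mul (h : CubicExpands n r c z K M G) (t : ℂ) :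
    CubicExpands n r c z K M fun w => t * G w := by
  simp only [CubicExpands, prod_mul_distrib, prod_const, card_range] at h ⊢
  rw [mul_assoc, h, mul_sum]
  refine sum_congr rfl fun k hk => ?_
  have hk : k ≤ n := Nat.lt_succ_iff.mp (mem_range.mp hk)
  rw [← Nat.add_sub_of_le hk, pow_add]
  simp only [Nat.add_sub_cancel_left]
  ring

/-- If the expansion holds at infinitely many points of an affine line of functions, it holds on
the whole line. -/
theorem CubicExpands.of_infinite (f g : ℂ → ℂ)
    (h : {t : ℂ | CubicExpands n r c z K M fun w => f w + t * g w}.Infinite) (t : ℂ) :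
    CubicExpands n r c z K M fun w => f w + t * g w := by
  let L : ℂ → Polynomial ℂ := fun w => Polynomial.C (f w) + Polynomial.X * Polynomial.C (g w)
  have hL : ∀ w t, (L w).eval t = f w + t * g w := fun w t => by
    simp only [L, Polynomial.eval_add, Polynomial.eval_mul, Polynomial.eval_C, Polynomial.eval_X]
  let P : Polynomial ℂ := (∏ j ∈ range n, L (z * r ^ (2 - 2 * (n : ℤ) + 4 * j))) * Polynomial.C K
  let Q : Polynomial ℂ := ∑ k ∈ range (n + 1),
    Polynomial.C (M k) * (∏ j ∈ range k, L (c * r ^ (2 * (n : ℤ) - 2 + 4 * j)))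
      * ∏ j ∈ range (n - k), L (r ^ (3 - 2 * (n : ℤ) + 2 * k + 4 * j))
  have key : ∀ t, CubicExpands n r c z K M (fun w => f w + t * g w) ↔ P.eval t = Q.eval t := by
    intro t
    simp only [P, Q, CubicExpands, Polynomial.eval_mul, Polynomial.eval_prod,
      Polynomial.eval_finsetSum, Polynomial.eval_C, hL]
  simp only [key] at h ⊢
  rw [Polynomial.eq_of_infinite_eval_eq P Q h]

end CubicExpands

/-- Both xy and x/y lie in the annulus |p| < |·| < 1. This yields a whole interval of parameters at
which the pairs are linearly independent. -/
theorem thetaPair_ofReal_ne_zero {p : ℂ} (hp : ‖p‖ < 1) {x y : ℝ} (hx : √‖p‖ < x) (hxy : x < y)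
    (hy : y < 1) : thetaPair p x y ≠ 0 := by
  have hx0 : 0 < x := (Real.sqrt_nonneg _).trans_lt hx
  have hy0 : 0 < y := hx0.trans hxy
  have hpxy : ‖p‖ < x * y := by
    rw [← Real.mul_self_sqrt (norm_nonneg p)]
    exact mul_lt_mul'' hx (hx.trans hxy) (Real.sqrt_nonneg _) (Real.sqrt_nonneg _)
  have n1 : ‖(x * y : ℂ)‖ = x * y := by
    rw [norm_mul, Complex.norm_of_nonneg hx0.le, Complex.norm_of_nonneg hy0.le]
  have n2 : ‖(x / y : ℂ)‖ = x / y := by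
    rw [norm_div, Complex.norm_of_nonneg hx0.le, Complex.norm_of_nonneg hy0.le]
  refine mul_ne_zero (jacTheta_ne_zero hp ?_ ?_) (jacTheta_ne_zero hp ?_ ?_)
  · rwa [n1]
  · rw [n1]; nlinarith
  · rw [n2, lt_div_iff₀ hy0]
    nlinarith [norm_nonneg p]
  · rw [n2, div_lt_one hy0]; exact hxy

/-- An expansion valid for all products `θ(b w) θ(b / w)` is valid for all even theta functions of
degree two. -/
theorem cubicExpands_of_thetaPair {p : ℂ} (hp : ‖p‖ < 1) {n : ℕ} {r c z K : ℂ} {M : ℕ → ℂ}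
    (hr : r ≠ 0) (hc : c ≠ 0) (hz : z ≠ 0)
    (h : ∀ b : ℂ, b ≠ 0 → CubicExpands n r c z K M (thetaPair p b)) (α β : ℂ) :
    CubicExpands n r c z K M fun w => α * thetaEven p w + β * thetaOdd p w := by
  obtain ⟨C, hC, hθ⟩ := exists_jacTheta_mul_jacTheta hp
  have hdet : ∀ x y : ℝ, x ∈ Set.Ioo (√‖p‖) 1 → y ∈ Set.Ioo (√‖p‖) 1 → x ≠ y →
      thetaOdd p x * thetaEven p y - thetaEven p x * thetaOdd p y ≠ 0 := by
    intro x y hx hy hxy h0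
    have hx0 : (x : ℂ) ≠ 0 := by exact_mod_cast ((Real.sqrt_nonneg _).trans_lt hx.1).ne'
    have hy0 : (y : ℂ) ≠ 0 := by exact_mod_cast ((Real.sqrt_nonneg _).trans_lt hy.1).ne'
    rcases lt_or_gt_of_ne hxy with hlt | hlt
    · refine thetaPair_ofReal_ne_zero hp hx.1 hlt hy.2 ?_
      rw [thetaPair, hθ _ _ hx0 hy0, h0, mul_zero]
    · refine thetaPair_ofReal_ne_zero hp hy.1 hlt hx.2 ?_
      rw [thetaPair, hθ _ _ hy0 hx0]
      linear_combination -(C * y) * h0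
  -- For α ≠ 0, let β vary. The pair with parameter x, scaled to have `thetaEven` coefficient α, has
  -- β = -α `thetaEven`(x)/`thetaOdd`(x); by `hdet` distinct x give distinct β, and `thetaOdd`
  -- vanishes at most once on the interval.
  have hgen : ∀ α : ℂ, α ≠ 0 → ∀ β : ℂ,
      CubicExpands n r c z K M fun w => α * thetaEven p w + β * thetaOdd p w := by
    intro α hα
    refine CubicExpands.of_infinite _ _ ?_
    let I : Set ℝ := Set.Ioo (√‖p‖) 1
    have hI : I.Infinite := Set.Ioo_infinite (by
      rw [Real.sqrt_lt' one_pos, one_pow]; exact hp)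
    have hZ : (I ∩ {x : ℝ | thetaOdd p x = 0}).Finite := by
      refine Set.Subsingleton.finite fun x hx y hy => ?_
      by_contra hxy
      have h1 : thetaOdd p x = 0 := hx.2
      have h2 : thetaOdd p y = 0 := hy.2
      exact hdet x y hx.1 hy.1 hxy (by rw [h1, h2, zero_mul, mul_zero, sub_zero])
    refine Set.infinite_of_injOn_mapsTo (f := fun x : ℝ => -(α * thetaEven p x / thetaOdd p x))
      (s := I \ (I ∩ {x : ℝ | thetaOdd p x = 0})) ?_ ?_ (hI.sdiff hZ)
    · intro x hx y hy hxy
      by_contra hne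
      have h1 : thetaOdd p x ≠ 0 := fun h => hx.2 ⟨hx.1, h⟩
      have h2 : thetaOdd p y ≠ 0 := fun h => hy.2 ⟨hy.1, h⟩
      refine hdet x y hx.1 hy.1 hne ?_
      simp only [neg_inj] at hxy
      rw [div_eq_div_iff h1 h2] at hxy
      refine mul_left_cancel₀ hα ?_
      linear_combination -hxy
    · intro x hx
      have h1 : thetaOdd p x ≠ 0 := fun h => hx.2 ⟨hx.1, h⟩
      have hx0 : (x : ℂ) ≠ 0 := by
        exact_mod_cast ((Real.sqrt_nonneg _).trans_lt hx.1.1).ne'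
      have hx := (h x hx0).const_mul (α / (C * x * thetaOdd p x))
      change CubicExpands n r c z K M fun w =>
        α * thetaEven p w + -(α * thetaEven p x / thetaOdd p x) * thetaOdd p w
      refine CubicExpands.congr hr hc hz hx fun w hw => ?_
      rw [thetaPair, hθ _ _ hx0 hw]
      field_simp
      ring
  rcases ne_or_eq α 0 with hα | rfl
  · exact hgen α hα β
  -- For α = 0 the line is taken in the direction of `thetaEven`: all t ≠ 0 are covered by `hgen`,
  -- and t = 0 is the missing case.
  · have := CubicExpands.of_infinite (n := n) (r := r) (c := c) (z := z) (K := K) (M := M)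
      (fun w => β * thetaOdd p w) (thetaEven p) ?_ 0
    · refine CubicExpands.congr hr hc hz this fun w _ => ?_
      ring
    · refine (Set.finite_singleton (0 : ℂ)).infinite_compl.mono fun t ht => ?_
      change CubicExpands n r c z K M fun w => β * thetaOdd p w + t * thetaEven p w
      exact CubicExpands.congr hr hc hz (hgen t ht β) fun w _ => add_comm _ _

/-! ### Specialisation and final assembly. -/

theorem prod_range_two_mul (f : ℕ → ℂ) (N : ℕ) :
    ∏ j ∈ range (2 * N), f j = ∏ i ∈ range N, (f (2 * i) * f (2 * i + 1)) := by
  induction N with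
  | zero => simp
  | succ N ih =>
    rw [prod_range_succ, ← ih, mul_add_one, prod_range_succ, prod_range_succ, mul_assoc]

/-- The coefficient of the cubic expansion, including the basis function. -/
noncomputable def cubicCoeff (p r e z : ℂ) (n k : ℕ) : ℂ :=
  e ^ k * r ^ ((k : ℤ) * (k - 2))
    * (thetaFac (r ^ (-4 * (n : ℤ))) (r ^ 4) p k / thetaFac (r ^ 4) (r ^ 4) p k)
    / thetaFac (e * r ^ (-1 : ℤ)) (r ^ 2) p k * expansionLead p r e n k * expansionBasis p r e z n k

/-- The elliptic expansion with e = c q^n and B = b q^((1-n)/2). The choice of B makes the exponents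
symmetric under j ↦ n - 1 - j, so the shifts can be moved from b to z; the factors of the
coefficient containing B become the values of the pair at the other nodes. -/
theorem cubicExpands_thetaPair {p r c z b : ℂ} (hp : ‖p‖ < 1) (hr : r ≠ 0) (hc : c ≠ 0) (hz : z ≠ 0)
    (hb : b ≠ 0) (n : ℕ) (h₁ : thetaFac (r ^ 4) (r ^ 4) p n ≠ 0)
    (h₂ : thetaFac (c * r ^ (4 * (n : ℤ)) * r ^ (-1 : ℤ)) (r ^ 2) p n ≠ 0) :
    CubicExpands n r c z
      (∏ i ∈ range n, (jacTheta (c * r ^ (4 * (n : ℤ)) * r ^ (-4 * (i : ℤ) - 5)) p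
        * jacTheta (c * r ^ (4 * (n : ℤ)) * r ^ (-4 * (i : ℤ) - 3)) p))
      (cubicCoeff p r (c * r ^ (4 * (n : ℤ))) z n) (thetaPair p b) := by
  have hzr : ∀ i : ℤ, r ^ i ≠ 0 := fun i => zpow_ne_zero _ hr
  have he : c * r ^ (4 * (n : ℤ)) ≠ 0 := mul_ne_zero hc (hzr _)
  have hB : b * r ^ (2 - 2 * (n : ℤ)) ≠ 0 := mul_ne_zero hb (hzr _)
  have key := prod_thetaPair_expansion hp hr he hB hz n h₁ h₂
  have arg1 : ∀ (x y : ℂ) (i j l : ℤ), i + j = l → x * r ^ i * (y * r ^ j) = x * y * r ^ l := by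
    rintro x y i j l rfl
    rw [mul_mul_mul_comm, zpow_add₀ hr]
  have hleft : ∏ j ∈ range n, thetaPair p b (z * r ^ (2 - 2 * (n : ℤ) + 4 * j))
      = ∏ j ∈ range n, thetaPair p (b * r ^ (2 - 2 * (n : ℤ)) * r ^ (4 * (j : ℤ))) z := by
    simp only [thetaPair, prod_mul_distrib]
    congr 1
    · refine prod_congr rfl fun j _ => ?_
      rw [zpow_add₀ hr]; ring_nf
    · rw [← prod_range_reflect]
      refine prod_congr rfl fun j hj => ?_
      have hj : j < n := mem_range.mp hj
      have e1 : 2 - 2 * (n : ℤ) + 4 * ((n - 1 - j : ℕ) : ℤ) = -(2 - 2 * (n : ℤ) + 4 * j) := by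
        omega
      rw [e1, zpow_neg, zpow_add₀ hr]
      congr 1
      have := hzr (2 - 2 * (n : ℤ))
      have := hzr (4 * (j : ℤ))
      field_simp
  rw [CubicExpands, hleft, key]
  refine sum_congr rfl fun k hk => ?_
  have hk : k ≤ n := Nat.lt_succ_iff.mp (mem_range.mp hk)
  have hmid : ∏ j ∈ range k, thetaPair p b (c * r ^ (2 * (n : ℤ) - 2 + 4 * j))
      = thetaFac (b * r ^ (2 - 2 * (n : ℤ)) * (c * r ^ (4 * (n : ℤ))) * r ^ (-4 : ℤ)) (r ^ 4) p k
        * thetaFac (b * r ^ (2 - 2 * (n : ℤ)) / (c * r ^ (4 * (n : ℤ))) * r ^ (4 * (n : ℤ)))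
          (r ^ 4)⁻¹ p k := by
    rw [thetaFac, thetaFac, ← prod_mul_distrib]
    refine prod_congr rfl fun j _ => ?_
    rw [mul_zpow_mul_pow_pow hr, mul_zpow_mul_inv_pow_pow hr, thetaPair]
    congr 2
    · have : r ^ (2 * (n : ℤ) - 2 + 4 * j)
          = r ^ (2 - 2 * (n : ℤ)) * r ^ (4 * (n : ℤ)) * r ^ ((-4 : ℤ) + (4 : ℕ) * j) := by
        rw [← zpow_add₀ hr, ← zpow_add₀ hr]; congr 1; push_cast; ring
      rw [this]; ring
    · have : r ^ (2 - 2 * (n : ℤ)) * r ^ (4 * (n : ℤ) - (4 : ℕ) * j)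
          = r ^ (4 * (n : ℤ)) * (r ^ (2 * (n : ℤ) - 2 + 4 * j))⁻¹ := by
        rw [← zpow_neg, ← zpow_add₀ hr, ← zpow_add₀ hr]; congr 1; push_cast; ring
      have h4 := hzr (4 * (n : ℤ))
      rw [div_mul_eq_mul_div, mul_assoc b, this]
      field_simp
  have hright : ∏ j ∈ range (n - k), thetaPair p b (r ^ (3 - 2 * (n : ℤ) + 2 * k + 4 * j))
      = thetaFac (b * r ^ (2 - 2 * (n : ℤ)) * r ^ (2 * (k : ℤ) - 1)) (r ^ 2) p (2 * (n - k)) := by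
    rw [thetaFac, prod_range_two_mul, prod_mul_distrib, mul_comm (∏ i ∈ range (n - k), _)]
    simp only [thetaPair, prod_mul_distrib]
    congr 1
    · refine prod_congr rfl fun j _ => ?_
      rw [mul_zpow_mul_pow_pow hr, mul_assoc, ← zpow_add₀ hr]
      congr 3
      push_cast; ring
    · rw [← prod_range_reflect]
      refine prod_congr rfl fun j hj => ?_
      have hj : j < n - k := mem_range.mp hj
      rw [mul_zpow_mul_pow_pow hr, mul_assoc, ← zpow_add₀ hr, div_eq_mul_inv, ← zpow_neg]
      congr 3
      push_cast
      omega
  rw [hmid, hright, expansionCoeff, expansionCore, cubicCoeff]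
  ring

theorem prod_jacTheta_reflect {p r : ℂ} (hr : r ≠ 0) (c : ℂ) (n : ℕ) :
    ∏ i ∈ range n, (jacTheta (c * r ^ (4 * (n : ℤ)) * r ^ (-4 * (i : ℤ) - 5)) p
        * jacTheta (c * r ^ (4 * (n : ℤ)) * r ^ (-4 * (i : ℤ) - 3)) p)
      = thetaFac (c * r ^ (-1 : ℤ)) (r ^ 4) p n * thetaFac (c * r) (r ^ 4) p n := by
  rw [thetaFac, thetaFac, ← prod_mul_distrib, ← prod_range_reflect]
  refine prod_congr rfl fun j hj => ?_
  have hj : j < n := mem_range.mp hj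
  have h1 := mul_zpow_mul_pow_pow hr c 1 4 j
  rw [zpow_one] at h1
  rw [mul_zpow_mul_pow_pow hr, h1, mul_assoc, mul_assoc, ← zpow_add₀ hr, ← zpow_add₀ hr]
  congr 4 <;> (push_cast; omega)

/-- Restores the quotient that was cancelled in `expansionLead`; this is where nonvanishing of the
denominator theta function enters. -/
theorem expansionLead_eq {p r c : ℂ} (hr : r ≠ 0) (n k : ℕ)
    (h : jacTheta (c * r ^ (2 * (k : ℤ) - 3)) p ≠ 0) :
    expansionLead p r (c * r ^ (4 * (n : ℤ))) n k
      = jacTheta (c * r ^ (6 * (k : ℤ) - 3)) p / jacTheta (c * r ^ (2 * (k : ℤ) - 3)) p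
        * thetaFac (c * r ^ (-1 : ℤ)) (r ^ 2) p k := by
  cases k with
  | zero =>
    have e1 : 6 * ((0 : ℕ) : ℤ) - 3 = 2 * ((0 : ℕ) : ℤ) - 3 := by norm_num
    rw [expansionLead, e1, div_self h, thetaFac_zero, one_mul]
  | succ k =>
    have e1 : 2 * ((k + 1 : ℕ) : ℤ) - 3 = 2 * (k : ℤ) - 1 := by push_cast; ring
    rw [e1] at h ⊢
    rw [expansionLead, thetaFac_zpow_succ hr c (-1) (2 * (k : ℤ) - 1) 2 k (by push_cast; ring),
      mul_assoc, mul_assoc, ← zpow_add₀ hr, ← zpow_add₀ hr]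
    have e2 : 4 * (n : ℤ) + (6 * k + 3 - 4 * n) = 6 * ((k + 1 : ℕ) : ℤ) - 3 := by push_cast; ring
    have e3 : 4 * (n : ℤ) + (-4 * n - 1) = -1 := by ring
    rw [e2, e3]
    field_simp

theorem expansionBasis_mul {p r c : ℂ} (hr : r ≠ 0) (z : ℂ) {n k : ℕ} (hk : k ≤ n) :
    expansionBasis p r (c * r ^ (4 * (n : ℤ))) z n k
        * (thetaFac (c * z) (r ^ 4) p k * thetaFac (c / z) (r ^ 4) p k)
      = thetaFac (r * z) (r ^ 2) p k * thetaFac (r / z) (r ^ 2) p k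
        * (thetaFac (c * z) (r ^ 4) p n * thetaFac (c / z) (r ^ 4) p n) := by
  have h1 : ∏ j ∈ range k, thetaPair p (r * (r ^ 2) ^ j) z
      = thetaFac (r * z) (r ^ 2) p k * thetaFac (r / z) (r ^ 2) p k := by
    rw [thetaFac, thetaFac, ← prod_mul_distrib]
    refine prod_congr rfl fun j _ => ?_
    rw [thetaPair, mul_right_comm, div_mul_eq_mul_div]
  have h2 : ∏ i ∈ range (n - k), thetaPair p (c * r ^ (4 * (n : ℤ)) * r ^ (-4 * (i : ℤ) - 4)) z
      = ∏ i ∈ range (n - k), (jacTheta (c * z * (r ^ 4) ^ (k + i)) p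
        * jacTheta (c / z * (r ^ 4) ^ (k + i)) p) := by
    rw [← prod_range_reflect]
    refine prod_congr rfl fun i hi => ?_
    have hi : i < n - k := mem_range.mp hi
    have e1 : c * r ^ (4 * (n : ℤ)) * r ^ (-4 * ((n - k - 1 - i : ℕ) : ℤ) - 4)
        = c * (r ^ 4) ^ (k + i) := by
      rw [mul_assoc, ← zpow_add₀ hr, ← pow_mul, ← zpow_natCast]
      congr 2
      push_cast
      omega
    rw [thetaPair, e1, mul_right_comm, div_mul_eq_mul_div]
  have h3 : ∀ x, thetaFac x (r ^ 4) p n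
      = thetaFac x (r ^ 4) p k * ∏ i ∈ range (n - k), jacTheta (x * (r ^ 4) ^ (k + i)) p := by
    intro x
    rw [thetaFac, ← Nat.add_sub_of_le hk, prod_range_add, Nat.add_sub_cancel_left, thetaFac]
  rw [expansionBasis, h1, h2, h3 (c * z), h3 (c / z), prod_mul_distrib]
  ring

/-- Brings cubic factorials of different lengths k to the same second argument of γ, the one
belonging to length n. -/
theorem cubicFac_eq_prod {a z a' z' p r : ℂ} {n k : ℕ} (i : ℤ) (hr : r ≠ 0)
    (ha : a * (r ^ 2) ^ ((k : ℤ) - 1) = a' * (r ^ 2) ^ ((n : ℤ) - 1))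
    (hz : z * r ^ (2 - 2 * (k : ℤ)) = z' * r ^ i) :
    cubicFac a z (r ^ 2) p k
      = ∏ j ∈ range k, cubicGamma (z' * r ^ (i + 4 * j)) (a' * (r ^ 2) ^ ((n : ℤ) - 1)) p := by
  rw [cubicFac]
  refine prod_congr rfl fun j _ => ?_
  rw [ha, zpow_add₀ hr, ← mul_assoc, ← hz, mul_assoc, ← zpow_add₀ hr, ← zpow_natCast r 2, ← zpow_mul]
  congr 3
  push_cast
  ring

/-- Here r = q^(1/4) and r² is the square root of q. The arguments of the last two cubic factorials
solve AZ = a c q^(n-1), A/Z = a q^(1-k)/c and AZ = a q^(k/2+1/4), A/Z = a q^(k/2-1/4). -/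
theorem corollary3p5 (n : ℕ) (q r p a c z : ℂ)
    (hp : ‖p‖ < 1) (hq : q ≠ 0) (hr : r ^ 4 = q)
    (ha : a ≠ 0) (hc : c ≠ 0) (hz : z ≠ 0)
    (h₁ : thetaFac (c * z) q p n ≠ 0) (h₂ : thetaFac (c / z) q p n ≠ 0)
    (h₃ : thetaFac q q p n ≠ 0)
    (h₄ : thetaFac (c * r ^ (4 * (n : ℤ) - 1)) (r ^ 2) p n ≠ 0)
    (h₅ : ∀ k ∈ Finset.range (n + 1), jacTheta (c * r ^ (2 * (k : ℤ) - 3)) p ≠ 0) :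
    cubicFac a z (r ^ 2) p n / (thetaFac (c * z) q p n * thetaFac (c / z) q p n)
        * (thetaFac (c * r ^ (-1 : ℤ)) q p n * thetaFac (c * r) q p n)
      = ∑ k ∈ Finset.range (n + 1),
          c ^ k * r ^ ((k : ℤ) * ((k : ℤ) - 2) + 4 * (n : ℤ) * (k : ℤ))
          * (jacTheta (c * r ^ (6 * (k : ℤ) - 3)) p / jacTheta (c * r ^ (2 * (k : ℤ) - 3)) p)
          * (thetaFac (q ^ (-(n : ℤ))) q p k / thetaFac q q p k)
          * (thetaFac (c * r ^ (-1 : ℤ)) (r ^ 2) p k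
              / thetaFac (c * r ^ (4 * (n : ℤ) - 1)) (r ^ 2) p k)
          * (thetaFac (r * z) (r ^ 2) p k * thetaFac (r / z) (r ^ 2) p k
              / (thetaFac (c * z) q p k * thetaFac (c / z) q p k))
          * cubicFac (a * (r ^ 2) ^ ((n : ℤ) - (k : ℤ))) (c * (r ^ 2) ^ ((n : ℤ) + (k : ℤ) - 2))
              (r ^ 2) p k
          * cubicFac (a * (r ^ 2) ^ k) r (r ^ 2) p (n - k) := by
  subst hr
  have hr : r ≠ 0 := by
    rintro rfl
    exact hq (by norm_num)
  have hr2 : r ^ 2 ≠ 0 := pow_ne_zero _ hr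
  have hsq : ∀ i : ℤ, (r ^ 2) ^ i = r ^ (2 * i) := fun i => by rw [zpow_mul]; rfl
  have e1 : c * r ^ (4 * (n : ℤ)) * r ^ (-1 : ℤ) = c * r ^ (4 * (n : ℤ) - 1) := by
    rw [mul_assoc, ← zpow_add₀ hr, ← sub_eq_add_neg]
  -- One pair α, β serves all factors, as the second argument of γ is always a q^((n-1)/2).
  obtain ⟨α, β, hγ⟩ := exists_cubicGamma_eq hp
    (mul_ne_zero ha (zpow_ne_zero ((n : ℤ) - 1) hr2))
  have key := (cubicExpands_of_thetaPair hp hr hc hz (fun b hb =>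
    cubicExpands_thetaPair hp hr hc hz hb n h₃ (by rwa [e1])) α β).congr hr hc hz
    fun w hw => (hγ w hw).symm
  rw [CubicExpands, prod_jacTheta_reflect hr] at key
  rw [cubicFac_eq_prod (n := n) (k := n) (a' := a) (z' := z) (2 - 2 * (n : ℤ)) hr rfl rfl,
    div_mul_eq_mul_div, key, sum_div]
  refine sum_congr rfl fun k hk => ?_
  have h5 := h₅ k hk
  have hk : k ≤ n := Nat.lt_succ_iff.mp (mem_range.mp hk)
  have hb := expansionBasis_mul (p := p) (c := c) hr z hk
  have hz1 := thetaFac_ne_zero_of_le h₁ hk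
  have hz2 := thetaFac_ne_zero_of_le h₂ hk
  rw [cubicFac_eq_prod (n := n) (k := k) (a' := a) (z' := c) (2 * (n : ℤ) - 2) hr ?_ ?_,
    cubicFac_eq_prod (n := n) (k := n - k) (a' := a) (z' := 1) (3 - 2 * (n : ℤ) + 2 * k) hr ?_ ?_]
  · simp only [one_mul]
    have e2 : (c * r ^ (4 * (n : ℤ))) ^ k * r ^ ((k : ℤ) * (k - 2))
        = c ^ k * r ^ ((k : ℤ) * ((k : ℤ) - 2) + 4 * (n : ℤ) * (k : ℤ)) := by
      rw [zpow_add₀ hr, zpow_mul r (4 * (n : ℤ)), zpow_natCast, mul_pow]; ring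
    have e3 : r ^ (-4 * (n : ℤ)) = (r ^ 4) ^ (-(n : ℤ)) := by
      rw [← zpow_natCast r 4, ← zpow_mul]; congr 1; push_cast; ring
    have e4 : expansionBasis p r (c * r ^ (4 * (n : ℤ))) z n k
        = thetaFac (r * z) (r ^ 2) p k * thetaFac (r / z) (r ^ 2) p k
          / (thetaFac (c * z) (r ^ 4) p k * thetaFac (c / z) (r ^ 4) p k)
          * (thetaFac (c * z) (r ^ 4) p n * thetaFac (c / z) (r ^ 4) p n) := by
      rw [div_mul_eq_mul_div, eq_div_iff (mul_ne_zero hz1 hz2), hb]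
    rw [cubicCoeff, e1, e2, e3, e4, expansionLead_eq hr n k h5,
      div_eq_iff (mul_ne_zero h₁ h₂)]
    ring
  · rw [← zpow_natCast (r ^ 2) k, mul_assoc, ← zpow_add₀ hr2]; congr 2; push_cast [hk]; ring
  · rw [one_mul, ← zpow_one_add₀ hr]; congr 1; push_cast [hk]; ring
  · rw [mul_assoc, ← zpow_add₀ hr2]; congr 2; ring
  · rw [hsq, mul_assoc, ← zpow_add₀ hr]; congr 2; ring
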